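/- Let $(\Omega,\mathcal F,P)$ be a probability space; $L_2=L_2(\Omega,\mathcal F,P)$ consists of real-valued or of complex-valued random variables. A continuous factorization (over $\mathbb R$) is a family $(\mathcal F_{s,t})_{s\le t}$ of sub-$\sigma$-fields of $\mathcal F$ such that (i) for all $r\le s\le t$, $\mathcal F_{r,s}$ and $\mathcal F_{s,t}$ are independent and together generate $\mathcal F_{r,t}$; (ii) $\bigcup_{\varepsilon>0}\mathcal F_{s+\varepsilon,t-\varepsilon}$ generates $\mathcal F_{s,t}$ whenever $s<t$; (iii) $\bigcup_{n\ge1}\mathcal F_{-n,n}$ generates $\mathcal F$. For an elementary set $E\subset\mathbb R$ (a finite union of intervals, bounded or not, with or without endpoints) let $\mathcal F_E$ be the $\sigma$-field generated by all $\mathcal F_{s,t}$ with $s<t$, $(s,t)\subset E$. Let $\mathcal C$ be the space of compact subsets of $\mathbb R$ (including $\emptyset$) with the Hausdorff metric and its Borel $\sigma$-field. The spectral measure $\mu_f$ of $f\in L_2$ is the finite positive measure on $\mathcal C$ such that $\mu_f(\{M\in\mathcal C: M\subset E\})=\|\mathbb E(f\mid\mathcal F_E)\|_{L_2}^2$ for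 every elementary set $E$. The first chaos is the set of all $f\in L_2$ such that $\mu_f$ is concentrated on the single-point sets. A compact set is perfect if it has no isolated points ($\emptyset$ is perfect). A noise is a continuous factorization together with a one-parameter group $(\alpha_t)_{t\in\mathbb R}$ of automorphisms (invertible measure preserving transformations mod $0$) of $(\Omega,\mathcal F,P)$ such that $\alpha_t^{-1}(\mathcal F_{r,s})=\mathcal F_{r-t,s-t}$ (mod $0$) for all $r\le s$ and $t$, and $P(D\bigtriangleup\alpha_t^{-1}(D))\to0$ as $t\to0$ for all $D\in\mathcal F$. An $f\in L_2$ is stable if $\mu_f$ is concentrated on the finite sets; the stable $\sigma$-field $\mathcal F_{\mathrm{stable}}$ is generated by all stable $f$ (null events included). A noise is black if $\mathcal F_{\mathrm{stable}}$ is degenerate, that is, contains only events of probability $0$ and $1$. Theorem. (1) For every continuous factorization, the spectral measure $\mu_f$ exists and is unique for every $f\in L_2$, and the following two conditions are equivalent: (a) the first chaos is trivial (contains only $0$); (b) for every $f\in L_2$ the spectral measure $\mu_f$ is concentrated on the set of all perfect compact subsets of $\mathbb R$. (2) A noise is black if and only if for every $f\in L_2$ the spectral measure $\mu_f$ is concentrated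 on the set of all perfect compact subsets of $\mathbb R$. -/

import Mathlib

open MeasureTheory ProbabilityTheory TopologicalSpace Filter Set
open scoped Topology ENNReal

/-- The space `Compacts ℝ` of compact subsets of `ℝ` (with the empty set) carries in Mathlib the
topology of the Hausdorff distance (the empty set is an isolated point). We equip it with the
corresponding Borel sigma-algebra. -/
instance instMeasurableSpaceCompactsReal : MeasurableSpace (Compacts ℝ) := borel (Compacts ℝ)

instance instBorelSpaceCompactsReal : BorelSpace (Compacts ℝ) := ⟨rfl⟩

/-- Elementary subsets of `ℝ`: finite unions of intervals (bounded or not, with or without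
endpoints; an interval is an order-connected set). -/
def IsElementarySet (E : Set ℝ) : Prop :=
  ∃ S : Set (Set ℝ), S.Finite ∧ (∀ I ∈ S, I.OrdConnected) ∧ E = ⋃₀ S

/-- The set of perfect compact subsets of `ℝ`, that is, those without isolated points.
The empty set is perfect. -/
def perfectCompacts : Set (Compacts ℝ) := {M | Perfect (M : Set ℝ)}

/-- The set of single-point subsets of `ℝ`. -/
def singlePointCompacts : Set (Compacts ℝ) := {M | ∃ t : ℝ, (M : Set ℝ) = {t}}

/-- The set of finite subsets of `ℝ`. -/
def finiteCompacts : Set (Compacts ℝ) := {M | (M : Set ℝ).Finite}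

/-- A continuous factorization of the probability space `(Ω, mΩ, P)` over `ℝ`. The values `F s t`
with `t < s` are irrelevant. -/
structure ContinuousFactorization {Ω : Type*} [mΩ : MeasurableSpace Ω] (P : Measure Ω) where
  /-- The two-parameter family of sub-sigma-fields. -/
  F : ℝ → ℝ → MeasurableSpace Ω
  le_ambient : ∀ s t : ℝ, s ≤ t → F s t ≤ mΩ
  /-- `F r s` and `F s t` are independent ... -/
  indep : ∀ r s t : ℝ, r ≤ s → s ≤ t → Indep (F r s) (F s t) P
  /-- ... and together generate `F r t`. -/
  sup_eq : ∀ r s t : ℝ, r ≤ s → s ≤ t → F r s ⊔ F s t = F r t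
  /-- The union of `F (s + ε) (t - ε)` over `ε > 0` generates `F s t`. -/
  inner_generates : ∀ s t : ℝ, s < t →
    ⨆ (ε : ℝ) (_ : 0 < ε) (_ : s + ε ≤ t - ε), F (s + ε) (t - ε) = F s t
  /-- The union of `F (-n) n` generates the whole sigma-field. -/
  exhausts : ⨆ n : ℕ, F (-(n : ℝ)) (n : ℝ) = mΩ

namespace ContinuousFactorization

variable {𝕜 : Type*} [RCLike 𝕜] {Ω : Type*} [mΩ : MeasurableSpace Ω] {P : Measure Ω}

/-- The sigma-field `F_E` of a set `E ⊆ ℝ`, generated by all `F s t` such that `(s, t) ⊆ E`.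
If `E = (s₁, t₁) ∪ ... ∪ (sₙ, tₙ)` with disjoint intervals, this is the sigma-field generated by
the independent sigma-fields `F s₁ t₁, ..., F sₙ tₙ`; endpoints do not matter. -/
def fieldOf (A : ContinuousFactorization P) (E : Set ℝ) : MeasurableSpace Ω :=
  ⨆ (s : ℝ) (t : ℝ) (_ : s < t) (_ : Ioo s t ⊆ E), A.F s t

/-- `μ` is a spectral measure of `f`: a finite measure on the space of compact subsets of `ℝ`
with `μ {M | M ⊆ E} = ‖𝔼 (f | F_E)‖²` (norm of `L₂`) for all elementary sets `E`. -/
def IsSpectralMeasure (A : ContinuousFactorization P) (f : Lp 𝕜 2 P)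
    (μ : Measure (Compacts ℝ)) : Prop :=
  IsFiniteMeasure μ ∧ ∀ E : Set ℝ, IsElementarySet E →
    μ {M : Compacts ℝ | (M : Set ℝ) ⊆ E} = (eLpNorm (P[(f : Ω → 𝕜) | A.fieldOf E]) 2 P) ^ 2

open Classical in
/-- The spectral measure `μ_f` of `f` (its existence and uniqueness are part of the theorem
below). -/
noncomputable def spectralMeasure (A : ContinuousFactorization P) (f : Lp 𝕜 2 P) :
    Measure (Compacts ℝ) :=
  if h : ∃ μ : Measure (Compacts ℝ), A.IsSpectralMeasure f μ then h.choose else 0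

variable (𝕜) in
/-- The subspace `H_𝓜` of `L₂(Ω, P)` that corresponds to a set `𝓜` of compact subsets of `ℝ`:
all `f` whose spectral measure is concentrated on `𝓜`. -/
def spectralSubspace (A : ContinuousFactorization P) (𝓜 : Set (Compacts ℝ)) :
    Set (Lp 𝕜 2 P) :=
  {f | A.spectralMeasure f 𝓜ᶜ = 0}

variable (𝕜) in
/-- The first chaos: the subspace that corresponds to the set of single-point sets. -/
def firstChaos (A : ContinuousFactorization P) : Set (Lp 𝕜 2 P) :=
  A.spectralSubspace 𝕜 singlePointCompacts

/-- `f` is stable if its spectral measure is concentrated on finite sets. -/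
def IsStable (A : ContinuousFactorization P) (f : Lp 𝕜 2 P) : Prop :=
  f ∈ A.spectralSubspace 𝕜 finiteCompacts

variable (𝕜) in
/-- The stable sigma-field: the one generated by all stable elements of `L₂(Ω, P)`. As these are
random variables up to equality almost everywhere, all null events are included. -/
def stableField (A : ContinuousFactorization P) : MeasurableSpace Ω :=
  MeasurableSpace.generateFrom
    {D : Set Ω | MeasurableSet D ∧ ∃ f : Lp 𝕜 2 P, A.IsStable f ∧
      ∃ B : Set 𝕜, MeasurableSet[borel 𝕜] B ∧ D =ᵐ[P] (f : Ω → 𝕜) ⁻¹' B}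

end ContinuousFactorization

/-- A noise: a continuous factorization with a one-parameter group of automorphisms (invertible
measure preserving transformations modulo null sets) `α t` such that
`(α t)⁻¹ (F r s) = F (r - t) (s - t)` (modulo null sets), acting continuously. -/
structure Noise {Ω : Type*} [MeasurableSpace Ω] (P : Measure Ω)
    extends ContinuousFactorization P where
  /-- The time shifts. -/
  α : ℝ → Ω → Ω
  measurePreserving : ∀ t : ℝ, MeasurePreserving (α t) P P
  shift_zero : α 0 =ᵐ[P] id
  shift_add : ∀ s t : ℝ, α (s + t) =ᵐ[P] α s ∘ α t
  preimage_field : ∀ r s t : ℝ, r ≤ s → ∀ D : Set Ω, MeasurableSet[F r s] D →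
    ∃ D' : Set Ω, MeasurableSet[F (r - t) (s - t)] D' ∧ α t ⁻¹' D =ᵐ[P] D'
  field_preimage : ∀ r s t : ℝ, r ≤ s → ∀ D' : Set Ω, MeasurableSet[F (r - t) (s - t)] D' →
    ∃ D : Set Ω, MeasurableSet[F r s] D ∧ α t ⁻¹' D =ᵐ[P] D'
  continuous_shift : ∀ D : Set Ω, MeasurableSet D →
    Tendsto (fun t : ℝ => P (symmDiff D (α t ⁻¹' D))) (𝓝 0) (𝓝 0)

variable (𝕜 : Type*) [RCLike 𝕜] in
/-- A noise is black if its stable sigma-field is degenerate, that is, contains only events of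
probability `0` and `1`. -/
def Noise.IsBlack {Ω : Type*} [MeasurableSpace Ω] {P : Measure Ω} (N : Noise P) : Prop :=
  ∀ D : Set Ω, MeasurableSet[N.toContinuousFactorization.stableField 𝕜] D → P D = 0 ∨ P D = 1

/-! For sets with finite frontier, the conditional expectations `proj E` are commuting orthogonal
projections, and the product for `E` and `E'` is the projection for `E ∩ E'` (`proj_proj`). The
reason is that `F_E'` is the join of `F_{E ∩ E'}` and `F_{E' \ E}`, the latter being independent of
`F_E`.

Existence of spectral measures: finitely many cut points `T` divide the line into cells, and the
commuting projections of the cells decompose `‖f‖ ^ 2` into weights of sets of cells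
(`exists_weights`). Placing each weight at a finite set of representatives gives a measure with the
right values for all `E` with frontier in `T`. These measures are tight, so they have a limit as `T`
grows; in the limit one inequality survives for open `E` and the opposite one for closed `E`.
Condition (ii) makes `proj E f` a limit along closed sets inside `E` and along open sets around `E`,
which restores equality. Uniqueness holds because the sets `{M | M ⊆ E}` form a pi-system generating
the Borel sigma-field.

First chaos and perfect sets: a compact set that is not perfect meets some rational interval in
exactly one point, so it suffices to show that for fixed `a`, `b` this happens with spectral measure
zero. The `f` for which it does form a closed subspace (`nullSubspace`). A vector `g` orthogonal to
it has no component on `(a, b)ᶜ` and splits additively at each `t ∈ (a, b)`. Localizing `g` by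
events of the outside and conditioning on `F_{(a,b)}` produces elements of the first chaos; if these
all vanish, so does `g`. Conversely, a single-point set is not perfect.

Blackness: elements of the first chaos are stable, so a degenerate stable field makes them
constants, hence `0`. If all spectral sets are perfect, those of a stable `f` are finite and
perfect, hence empty, so `f` is constant. -/

/-! ### Generators of joins of sigma-algebras -/

section PiSystems

variable {Ω : Type*}

theorem MeasurableSpace.isPiSystem_image2_inter (m₁ m₂ : MeasurableSpace Ω) :
    IsPiSystem (image2 (· ∩ ·) {A | MeasurableSet[m₁] A} {B | MeasurableSet[m₂] B}) := by
  rintro _ ⟨A, hA, B, hB, rfl⟩ _ ⟨A', hA', B', hB', rfl⟩ _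
  exact ⟨A ∩ A', hA.inter hA', B ∩ B', hB.inter hB', inter_inter_inter_comm _ _ _ _⟩

theorem MeasurableSpace.sup_eq_generateFrom_image2_inter (m₁ m₂ : MeasurableSpace Ω) :
    m₁ ⊔ m₂ = MeasurableSpace.generateFrom
      (image2 (· ∩ ·) {A | MeasurableSet[m₁] A} {B | MeasurableSet[m₂] B}) := by
  refine le_antisymm (sup_le (fun A hA => ?_) fun B hB => ?_) ?_
  · exact MeasurableSpace.measurableSet_generateFrom
      ⟨A, hA, univ, MeasurableSet.univ, inter_univ _⟩
  · exact MeasurableSpace.measurableSet_generateFrom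
      ⟨univ, MeasurableSet.univ, B, hB, univ_inter _⟩
  · refine MeasurableSpace.generateFrom_le ?_
    rintro _ ⟨A, hA, B, hB, rfl⟩
    have h₁ : m₁ ≤ m₁ ⊔ m₂ := le_sup_left
    have h₂ : m₂ ≤ m₁ ⊔ m₂ := le_sup_right
    exact MeasurableSet.inter (h₁ _ hA) (h₂ _ hB)

/-- If the set integrals of an integrable function vanish on a pi-system and on the whole space,
they vanish on the sigma-algebra generated by the pi-system. -/
theorem MeasureTheory.setIntegral_eq_zero_of_isPiSystem {V : Type*} [NormedAddCommGroup V]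
    [NormedSpace ℝ V] {m mΩ : MeasurableSpace Ω} (hm : m ≤ mΩ) {μ : Measure Ω}
    {S : Set (Set Ω)} (hS : m = MeasurableSpace.generateFrom S) (hpi : IsPiSystem S)
    {h : Ω → V} (hh : Integrable h μ) (huniv : ∫ x, h x ∂μ = 0)
    (hzero : ∀ A ∈ S, ∫ x in A, h x ∂μ = 0) {A : Set Ω} (hA : MeasurableSet[m] A) :
    ∫ x in A, h x ∂μ = 0 := by
  induction A, hA using MeasurableSpace.induction_on_inter hS hpi with
  | empty => simp
  | basic A hA => exact hzero A hA
  | compl A hA ih =>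
    have := integral_add_compl (hm A hA) hh
    rwa [ih, zero_add, huniv] at this
  | iUnion f hd hf ih =>
    rw [integral_iUnion (fun i => hm _ (hf i)) hd hh.integrableOn]
    simp [ih]

/-- On intersections of generators, independence of `G` and `G'` separates the four factors into two
pairs, and each pair factorizes by its own independence. -/
theorem ProbabilityTheory.Indep.sup_sup {mΩ : MeasurableSpace Ω} {P : Measure Ω}
    [IsProbabilityMeasure P] {G G' m₁ m₂ m₃ m₄ : MeasurableSpace Ω} (hG : G ≤ mΩ) (hG' : G' ≤ mΩ)
    (h₁ : m₁ ≤ G) (h₂ : m₂ ≤ G) (h₃ : m₃ ≤ G') (h₄ : m₄ ≤ G') (hGG' : Indep G G' P)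
    (h₁₂ : Indep m₁ m₂ P) (h₃₄ : Indep m₃ m₄ P) : Indep (m₁ ⊔ m₃) (m₂ ⊔ m₄) P := by
  refine IndepSets.indep (sup_le (h₁.trans hG) (h₃.trans hG'))
    (sup_le (h₂.trans hG) (h₄.trans hG'))
    (MeasurableSpace.isPiSystem_image2_inter m₁ m₃) (MeasurableSpace.isPiSystem_image2_inter m₂ m₄)
    (MeasurableSpace.sup_eq_generateFrom_image2_inter m₁ m₃)
    (MeasurableSpace.sup_eq_generateFrom_image2_inter m₂ m₄) ?_
  rw [IndepSets_iff]
  rintro _ _ ⟨A, hA, B, hB, rfl⟩ ⟨A', hA', B', hB', rfl⟩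
  rw [Indep_iff] at hGG' h₁₂ h₃₄
  simp only [mem_ofPred_eq] at hA hB hA' hB'
  rw [inter_inter_inter_comm, hGG' _ _ (MeasurableSet.inter (h₁ _ hA) (h₂ _ hA'))
    (MeasurableSet.inter (h₃ _ hB) (h₄ _ hB')), h₁₂ _ _ hA hA', h₃₄ _ _ hB hB',
    hGG' _ _ (h₁ _ hA) (h₃ _ hB), hGG' _ _ (h₂ _ hA') (h₄ _ hB')]
  ring

end PiSystems

/-! ### Sets of real numbers with finite frontier -/

section FiniteFrontier

theorem IsPreconnected.subset_or_disjoint_of_frontier {X : Type*} [TopologicalSpace X]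
    {s E : Set X} (hs : IsPreconnected s) (h : frontier E ∩ s = ∅) : s ⊆ E ∨ Disjoint s E := by
  by_contra! hc
  obtain ⟨x, hx, hxE⟩ := not_subset.1 hc.1
  obtain ⟨y, hy, hyE⟩ := not_disjoint_iff.1 hc.2
  have hcover : s ⊆ interior E ∪ interior Eᶜ := by
    intro z hz
    by_contra hcon
    have : z ∈ frontier E ∩ s := by
      rw [frontier_eq_inter_compl_interior]
      simp only [mem_union, not_or] at hcon
      exact ⟨hcon, hz⟩
    rw [h] at this
    exact this
  have hxi : x ∈ interior Eᶜ := (hcover hx).resolve_left fun hh => hxE (interior_subset hh)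
  have hyi : y ∈ interior E := (hcover hy).resolve_right fun hh => interior_subset hh hyE
  obtain ⟨z, -, hz₁, hz₂⟩ := hs _ _ isOpen_interior isOpen_interior hcover ⟨y, hy, hyi⟩ ⟨x, hx, hxi⟩
  exact interior_subset hz₂ (interior_subset hz₁)

/-- Induction over a bounded interval cut at the frontier points of `E`. -/
theorem Ioo_induction_of_finite_frontier {E : Set ℝ} (hE : (frontier E).Finite)
    {p : ℝ → ℝ → Prop} (subset : ∀ a b, a < b → Ioo a b ⊆ E → p a b)
    (disj : ∀ a b, a < b → Disjoint (Ioo a b) E → p a b)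
    (split : ∀ a t b, a < t → t < b → p a t → p t b → p a b) : ∀ a b, a < b → p a b := by
  -- The cut point lies in neither open half, so both halves contain strictly fewer frontier points.
  suffices H : ∀ n : ℕ, ∀ a b, a < b → (frontier E ∩ Ioo a b).ncard = n → p a b from
    fun a b hab => H _ a b hab rfl
  intro n
  induction n using Nat.strong_induction_on with
  | _ n ih =>
    intro a b hab hn
    rcases (frontier E ∩ Ioo a b).eq_empty_or_nonempty with he | ⟨t, htE, hat, htb⟩
    · exact (isPreconnected_Ioo.subset_or_disjoint_of_frontier he).elim (subset a b hab) (disj a b hab)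
    · have hfin : (frontier E ∩ Ioo a b).Finite := hE.inter_of_left _
      refine split a t b hat htb (ih _ ?_ a t hat rfl) (ih _ ?_ t b htb rfl)
      · rw [← hn]
        refine ncard_lt_ncard ⟨inter_subset_inter_right _ (Ioo_subset_Ioo_right htb.le), ?_⟩ hfin
        exact fun hs => lt_irrefl t (hs ⟨htE, hat, htb⟩).2.2
      · rw [← hn]
        refine ncard_lt_ncard ⟨inter_subset_inter_right _ (Ioo_subset_Ioo_left hat.le), ?_⟩ hfin
        exact fun hs => lt_irrefl t (hs ⟨htE, hat, htb⟩).2.1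

theorem Set.Finite.finite_frontier {T : Set ℝ} (hT : T.Finite) : (frontier T).Finite :=
  hT.subset hT.isClosed.frontier_subset

theorem finite_frontier_compl {E : Set ℝ} (hE : (frontier E).Finite) : (frontier Eᶜ).Finite := by
  rwa [frontier_compl]

theorem finite_frontier_inter {E E' : Set ℝ} (hE : (frontier E).Finite)
    (hE' : (frontier E').Finite) : (frontier (E ∩ E')).Finite :=
  (hE.union hE').subset ((frontier_inter_subset _ _).trans
    (union_subset_union inter_subset_left inter_subset_right))

theorem finite_frontier_union {E E' : Set ℝ} (hE : (frontier E).Finite)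
    (hE' : (frontier E').Finite) : (frontier (E ∪ E')).Finite :=
  (hE.union hE').subset ((frontier_union_subset _ _).trans
    (union_subset_union inter_subset_left inter_subset_right))

theorem finite_frontier_diff {E E' : Set ℝ} (hE : (frontier E).Finite)
    (hE' : (frontier E').Finite) : (frontier (E \ E')).Finite :=
  finite_frontier_inter hE (finite_frontier_compl hE')

theorem finite_frontier_biUnion {ι : Type*} {s : Set ι} (hs : s.Finite) {E : ι → Set ℝ}
    (hE : ∀ i ∈ s, (frontier (E i)).Finite) : (frontier (⋃ i ∈ s, E i)).Finite := by
  induction s, hs using Set.Finite.induction_on with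
  | empty => simp
  | insert _ _ ih =>
    rw [biUnion_insert]
    exact finite_frontier_union (hE _ (mem_insert _ _)) (ih fun i hi => hE i (mem_insert_of_mem _ hi))

theorem finite_frontier_of_ordConnected {I : Set ℝ} (hI : I.OrdConnected) :
    (frontier I).Finite := by
  have hc : I.OrdConnected → IsPreconnected I := fun h => h.isPreconnected
  rcases (hc hI).mem_intervals with h
  simp only [mem_insert_iff, mem_singleton_iff] at h
  have h₁ : ∀ x : ℝ, (frontier (Iic x)).Finite := fun x => by simp
  have h₂ : ∀ x : ℝ, (frontier (Iio x)).Finite := fun x => by simp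
  have h₃ : ∀ x : ℝ, (frontier (Ici x)).Finite := fun x => by simp
  have h₄ : ∀ x : ℝ, (frontier (Ioi x)).Finite := fun x => by simp
  rcases h with h | h | h | h | h | h | h | h | h | h <;> rw [h]
  · exact finite_frontier_inter (h₃ _) (h₁ _)
  · exact finite_frontier_inter (h₃ _) (h₂ _)
  · exact finite_frontier_inter (h₄ _) (h₁ _)
  · exact finite_frontier_inter (h₄ _) (h₂ _)
  · exact h₃ _
  · exact h₄ _
  · exact h₁ _
  · exact h₂ _
  · simp
  · simp

theorem IsElementarySet.finite_frontier {E : Set ℝ} (hE : IsElementarySet E) :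
    (frontier E).Finite := by
  obtain ⟨S, hS, hI, rfl⟩ := hE
  rw [sUnion_eq_biUnion]
  exact finite_frontier_biUnion hS fun I hIS => finite_frontier_of_ordConnected (hI I hIS)

theorem Set.OrdConnected.isElementarySet {I : Set ℝ} (hI : I.OrdConnected) : IsElementarySet I :=
  ⟨{I}, finite_singleton I, by simpa using hI, by simp⟩

theorem IsElementarySet.union {E E' : Set ℝ} (hE : IsElementarySet E) (hE' : IsElementarySet E') :
    IsElementarySet (E ∪ E') := by
  obtain ⟨S, hS, hI, rfl⟩ := hE
  obtain ⟨S', hS', hI', rfl⟩ := hE'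
  exact ⟨S ∪ S', hS.union hS', fun I h => h.elim (hI I) (hI' I), (sUnion_union S S').symm⟩

theorem IsElementarySet.inter {E E' : Set ℝ} (hE : IsElementarySet E) (hE' : IsElementarySet E') :
    IsElementarySet (E ∩ E') := by
  obtain ⟨S, hS, hI, rfl⟩ := hE
  obtain ⟨S', hS', hI', rfl⟩ := hE'
  refine ⟨image2 (· ∩ ·) S S', hS.image2 _ hS', ?_, ?_⟩
  · rintro _ ⟨I, h, J, h', rfl⟩
    exact (hI I h).inter (hI' J h')
  · ext x
    simp only [mem_inter_iff, mem_sUnion, mem_image2]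
    constructor
    · rintro ⟨⟨I, h, hx⟩, J, h', hx'⟩
      exact ⟨I ∩ J, ⟨I, h, J, h', rfl⟩, hx, hx'⟩
    · rintro ⟨_, ⟨I, h, J, h', rfl⟩, hx, hx'⟩
      exact ⟨⟨I, h, hx⟩, J, h', hx'⟩

end FiniteFrontier

/-! ### The sigma-fields of sets with finite frontier -/

namespace ContinuousFactorization

variable {Ω : Type*} [mΩ : MeasurableSpace Ω] {P : Measure Ω} (A : ContinuousFactorization P)

theorem F_mono {r s t u : ℝ} (hrs : r ≤ s) (hst : s ≤ t) (htu : t ≤ u) : A.F s t ≤ A.F r u := by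
  rw [← A.sup_eq r s u hrs (hst.trans htu), ← A.sup_eq s t u hst htu]
  exact le_sup_left.trans le_sup_right

theorem F_le_fieldOf {E : Set ℝ} {s t : ℝ} (hst : s < t) (h : Ioo s t ⊆ E) :
    A.F s t ≤ A.fieldOf E :=
  le_iSup_of_le s (le_iSup_of_le t (le_iSup_of_le hst (le_iSup_of_le h le_rfl)))

theorem fieldOf_le_iff {Ω : Type*} {m : MeasurableSpace Ω} [mΩ : MeasurableSpace Ω] {P : Measure Ω}
    (A : ContinuousFactorization P) {E : Set ℝ} :
    A.fieldOf E ≤ m ↔ ∀ s t, s < t → Ioo s t ⊆ E → A.F s t ≤ m := by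
  simp [fieldOf, iSup_le_iff]

theorem fieldOf_le (E : Set ℝ) : A.fieldOf E ≤ mΩ :=
  A.fieldOf_le_iff.2 fun s t hst _ => A.le_ambient s t hst.le

theorem fieldOf_mono {E E' : Set ℝ} (h : E ⊆ E') : A.fieldOf E ≤ A.fieldOf E' :=
  A.fieldOf_le_iff.2 fun _ _ hst h' => A.F_le_fieldOf hst (h'.trans h)

theorem fieldOf_Ioo_le (s t : ℝ) : A.fieldOf (Ioo s t) ≤ A.F s t := by
  refine A.fieldOf_le_iff.2 fun a b hab h => ?_
  rw [Ioo_subset_Ioo_iff hab] at h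
  exact A.F_mono h.1 hab.le h.2

theorem fieldOf_univ : A.fieldOf univ = mΩ := by
  refine le_antisymm (A.fieldOf_le _) ?_
  conv_lhs => rw [← A.exhausts]
  refine iSup_le fun n => ?_
  have hn : (0 : ℝ) ≤ n := Nat.cast_nonneg n
  -- `fieldOf` collects only nondegenerate intervals, and for `n = 0` the interval shrinks to a
  -- point; hence the widening by one.
  refine (A.F_mono (r := -n - 1) (u := n + 1) (by linarith) (by linarith) (by linarith)).trans ?_
  exact A.F_le_fieldOf (by linarith) (subset_univ _)

theorem fieldOf_finite {T : Set ℝ} (hT : T.Finite) : A.fieldOf T = ⊥ := by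
  refine le_bot_iff.1 (A.fieldOf_le_iff.2 fun s t hst h => ?_)
  exact absurd (hT.subset h) (Ioo_infinite hst)

/-- An interval in `E` is cut at the frontier points of `E'` into pieces inside or outside `E'`, and
`sup_eq` glues the pieces. -/
theorem fieldOf_eq_sup {E' : Set ℝ} (hE' : (frontier E').Finite) (E : Set ℝ) :
    A.fieldOf E = A.fieldOf (E ∩ E') ⊔ A.fieldOf (E \ E') := by
  refine le_antisymm (A.fieldOf_le_iff.2 fun s t hst h => ?_)
    (sup_le (A.fieldOf_mono inter_subset_left) (A.fieldOf_mono sdiff_subset))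
  have key : ∀ a b, a < b → A.F a b ≤ A.fieldOf (Ioo a b ∩ E') ⊔ A.fieldOf (Ioo a b \ E') := by
    refine Ioo_induction_of_finite_frontier hE' ?_ ?_ ?_
    · exact fun a b hab hs => (A.F_le_fieldOf hab (subset_inter Subset.rfl hs)).trans le_sup_left
    · exact fun a b hab hd =>
        (A.F_le_fieldOf hab (subset_sdiff.2 ⟨Subset.rfl, hd⟩)).trans le_sup_right
    · intro a t b hat htb h₁ h₂
      rw [← A.sup_eq a t b hat.le htb.le]
      refine sup_le (h₁.trans (sup_le_sup ?_ ?_)) (h₂.trans (sup_le_sup ?_ ?_)) <;>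
        refine A.fieldOf_mono ?_
      · exact inter_subset_inter_left _ (Ioo_subset_Ioo_right htb.le)
      · exact sdiff_subset_sdiff_left (Ioo_subset_Ioo_right htb.le)
      · exact inter_subset_inter_left _ (Ioo_subset_Ioo_left hat.le)
      · exact sdiff_subset_sdiff_left (Ioo_subset_Ioo_left hat.le)
  exact (key s t hst).trans (sup_le_sup (A.fieldOf_mono (inter_subset_inter_left _ h))
    (A.fieldOf_mono (sdiff_subset_sdiff_left h)))

theorem fieldOf_diff_finite {T : Set ℝ} (hT : T.Finite) (E : Set ℝ) :
    A.fieldOf (E \ T) = A.fieldOf E := by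
  rw [A.fieldOf_eq_sup hT.finite_frontier E, A.fieldOf_finite (hT.inter_of_right E), bot_sup_eq]

theorem fieldOf_congr {T : Set ℝ} (hT : T.Finite) {E E' : Set ℝ} (h : E \ T = E' \ T) :
    A.fieldOf E = A.fieldOf E' := by
  rw [← A.fieldOf_diff_finite hT E, h, A.fieldOf_diff_finite hT]

theorem fieldOf_eq_iSup (E : Set ℝ) :
    A.fieldOf E = ⨆ n : ℕ, A.fieldOf (Ioo (-(n + 1 : ℝ)) (n + 1) ∩ E) := by
  refine le_antisymm (A.fieldOf_le_iff.2 fun s t hst h => ?_)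
    (iSup_le fun n => A.fieldOf_mono inter_subset_right)
  obtain ⟨n, hn⟩ := exists_nat_gt (max |s| |t|)
  refine le_iSup_of_le n (A.F_le_fieldOf hst (subset_inter (Ioo_subset_Ioo ?_ ?_) h))
  · have := neg_abs_le s
    have := (le_max_left |s| |t|).trans hn.le
    linarith
  · have := le_abs_self t
    have := (le_max_right |s| |t|).trans hn.le
    linarith

variable [IsProbabilityMeasure P]

/-- On a piece inside or outside `E` one of the two fields is trivial. At a cut point both fields
split into a left and a right part, and `Indep.sup_sup` applies with `F a t` and `F t b`. -/
theorem indep_fieldOf_Ioo {E : Set ℝ} (hE : (frontier E).Finite) :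
    ∀ a b, a < b → Indep (A.fieldOf (Ioo a b ∩ E)) (A.fieldOf (Ioo a b \ E)) P := by
  have cut : ∀ (D : Set ℝ) (a t b : ℝ), a < t → t < b →
      A.fieldOf (Ioo a b ∩ D) = A.fieldOf (Ioo a t ∩ D) ⊔ A.fieldOf (Ioo t b ∩ D) := by
    intro D a t b hat htb
    rw [A.fieldOf_eq_sup (E' := Iio t) (by simp) (Ioo a b ∩ D)]
    congr 1
    · congr 1
      ext x
      simp only [mem_inter_iff, mem_Ioo, mem_Iio]
      exact ⟨fun h => ⟨⟨h.1.1.1, h.2⟩, h.1.2⟩, fun h => ⟨⟨⟨h.1.1, h.1.2.trans htb⟩, h.2⟩, h.1.2⟩⟩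
    · refine A.fieldOf_congr (finite_singleton t) ?_
      ext x
      simp only [Set.mem_sdiff, mem_inter_iff, mem_Ioo, mem_Iio, mem_singleton_iff, not_lt]
      constructor
      · rintro ⟨⟨⟨⟨_, h₁⟩, h₂⟩, h₃⟩, h₄⟩
        exact ⟨⟨⟨lt_of_le_of_ne h₃ (Ne.symm h₄), h₁⟩, h₂⟩, h₄⟩
      · rintro ⟨⟨⟨h₁, h₂⟩, h₃⟩, h₄⟩
        exact ⟨⟨⟨⟨hat.trans h₁, h₂⟩, h₃⟩, h₁.le⟩, h₄⟩
  refine Ioo_induction_of_finite_frontier hE ?_ ?_ ?_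
  · intro a b _ h
    rw [sdiff_eq_empty.2 h, A.fieldOf_finite finite_empty]
    exact indep_bot_right _
  · intro a b _ h
    rw [h.inter_eq, A.fieldOf_finite finite_empty]
    exact indep_bot_left _
  · intro a t b hat htb h₁ h₂
    rw [Set.sdiff_eq, cut E a t b hat htb, cut Eᶜ a t b hat htb]
    refine Indep.sup_sup (A.le_ambient a t hat.le) (A.le_ambient t b htb.le) ?_ ?_ ?_ ?_
      (A.indep a t b hat.le htb.le) h₁ h₂
    · exact (A.fieldOf_mono inter_subset_left).trans (A.fieldOf_Ioo_le a t)
    · exact (A.fieldOf_mono inter_subset_left).trans (A.fieldOf_Ioo_le a t)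
    · exact (A.fieldOf_mono inter_subset_left).trans (A.fieldOf_Ioo_le t b)
    · exact (A.fieldOf_mono inter_subset_left).trans (A.fieldOf_Ioo_le t b)

/-- The bounded case passes to increasing unions of windows, one field at a time; windows `n` and
`k` both fit into the window `max n k`. -/
theorem indep_fieldOf {E E' : Set ℝ} (hE : (frontier E).Finite) (h : Disjoint E E') :
    Indep (A.fieldOf E) (A.fieldOf E') P := by
  refine indep_of_indep_of_le_right ?_ (A.fieldOf_mono (subset_compl_iff_disjoint_left.2 h))
  have mono : ∀ D : Set ℝ,
      Monotone fun n : ℕ => A.fieldOf (Ioo (-(n + 1 : ℝ)) (n + 1) ∩ D) := by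
    intro D n k hnk
    have : (n : ℝ) ≤ k := Nat.cast_le.2 hnk
    exact A.fieldOf_mono (inter_subset_inter_left _ (Ioo_subset_Ioo (by linarith) (by linarith)))
  rw [A.fieldOf_eq_iSup E, A.fieldOf_eq_iSup Eᶜ]
  refine indep_iSup_of_monotone (fun n => ?_) (fun n => A.fieldOf_le _)
    (iSup_le fun n => A.fieldOf_le _) (mono E)
  refine (indep_iSup_of_monotone (fun k => ?_) (fun n => A.fieldOf_le _)
    (A.fieldOf_le _) (mono Eᶜ)).symm
  have hN : (0 : ℝ) ≤ (max n k : ℕ) := Nat.cast_nonneg _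
  have := A.indep_fieldOf_Ioo hE (-((max n k : ℕ) + 1 : ℝ)) ((max n k : ℕ) + 1) (by linarith)
  exact (indep_of_indep_of_le this (mono E (le_max_left n k)) (mono Eᶜ (le_max_right n k))).symm

end ContinuousFactorization

/-! ### Conditional expectations and independence -/

/-- If `m ≤ m₁` and `m₂` is independent of `m₁`, then conditioning an `m₁`-conditional expectation
on `m ⊔ m₂` amounts to conditioning on `m`. -/
theorem MeasureTheory.condExp_condExp_sup_of_indep {Ω V : Type*} [NormedAddCommGroup V]
    [NormedSpace ℝ V] [CompleteSpace V] {m m₁ m₂ mΩ : MeasurableSpace Ω} {P : Measure Ω}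
    [IsProbabilityMeasure P] (hm : m ≤ m₁) (hm₁ : m₁ ≤ mΩ) (hm₂ : m₂ ≤ mΩ) (hind : Indep m₁ m₂ P)
    {f : Ω → V} (hf : Integrable f P) : P[P[f|m₁]|m ⊔ m₂] =ᵐ[P] P[f|m] := by
  have hsup : m ⊔ m₂ ≤ mΩ := sup_le (hm.trans hm₁) hm₂
  symm
  refine ae_eq_condExp_of_forall_setIntegral_eq hsup integrable_condExp
    (fun s _ _ => integrable_condExp.integrableOn) (fun s hs _ => ?_)
    (stronglyMeasurable_condExp.mono (le_sup_left : m ≤ m ⊔ m₂)).aestronglyMeasurable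
  set h : Ω → V := fun x => P[f|m] x - P[f|m₁] x with hdef
  have hint : Integrable h P := integrable_condExp.sub integrable_condExp
  have hmeas : StronglyMeasurable[m₁] h :=
    (stronglyMeasurable_condExp.mono hm).sub stronglyMeasurable_condExp
  have hzero : ∀ B, MeasurableSet[m] B → ∫ x in B, h x ∂P = 0 := by
    intro B hB
    rw [integral_sub integrable_condExp.integrableOn integrable_condExp.integrableOn,
      setIntegral_condExp (hm.trans hm₁) hf hB, setIntegral_condExp hm₁ hf (hm _ hB), sub_self]
  have key : ∫ x in s, h x ∂P = 0 := by
    refine setIntegral_eq_zero_of_isPiSystem hsup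
      (MeasurableSpace.sup_eq_generateFrom_image2_inter m m₂)
      (MeasurableSpace.isPiSystem_image2_inter m m₂) hint ?_ ?_ hs
    · simpa using hzero univ MeasurableSet.univ
    · rintro _ ⟨A, hA, B, hB, rfl⟩
      have hA' : MeasurableSet A := hm₁ _ (hm _ hA)
      -- `A.indicator h` is independent of `m₂`, so conditioning it on `m₂` gives the constant `∫ x
      -- in A, h x ∂P`, which is zero.
      have h₁ : StronglyMeasurable[m₁] (A.indicator h) := hmeas.indicator (hm _ hA)
      have h₂ := condExp_indep_eq hm₁ hm₂ h₁ hind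
      simp only [inter_comm A B]
      rw [← setIntegral_indicator hA',
        ← setIntegral_condExp hm₂ (hint.indicator hA') hB,
        setIntegral_congr_ae (g := fun _ => (0 : V)) (hm₂ _ hB)]
      · simp
      · filter_upwards [h₂] with x hx _
        rw [hx, integral_indicator hA', hzero A hA]
  rw [integral_sub integrable_condExp.integrableOn integrable_condExp.integrableOn,
    sub_eq_zero] at key
  exact key

theorem MeasureTheory.Lp.integrable_two {V Ω : Type*} [NormedAddCommGroup V]
    {mΩ : MeasurableSpace Ω} {P : Measure Ω} [IsProbabilityMeasure P] (f : Lp V 2 P) :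
    Integrable f P :=
  (Lp.memLp f).integrable one_le_two

/-! ### The projections `𝔼 (· | F_E)` -/

namespace ContinuousFactorization

variable (𝕜 : Type*) [RCLike 𝕜] {Ω : Type*} [mΩ : MeasurableSpace Ω] {P : Measure Ω}
  (A : ContinuousFactorization P)

/-- The conditional expectation given `F_E`, as an operator on `L₂`. -/
noncomputable def proj (E : Set ℝ) : Lp 𝕜 2 P →L[𝕜] Lp 𝕜 2 P :=
  (lpMeas 𝕜 𝕜 (A.fieldOf E) 2 P).subtypeL ∘L condExpL2 𝕜 𝕜 (A.fieldOf_le E)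

variable {𝕜}

theorem aestronglyMeasurable_proj (E : Set ℝ) (f : Lp 𝕜 2 P) :
    AEStronglyMeasurable[A.fieldOf E] (A.proj 𝕜 E f) P :=
  aestronglyMeasurable_condExpL2 (A.fieldOf_le E) f

theorem inner_proj_left (E : Set ℝ) (f g : Lp 𝕜 2 P) :
    inner 𝕜 (A.proj 𝕜 E f) g = inner 𝕜 f (A.proj 𝕜 E g) :=
  inner_condExpL2_left_eq_right (A.fieldOf_le E)

theorem norm_proj_le (E : Set ℝ) (f : Lp 𝕜 2 P) : ‖A.proj 𝕜 E f‖ ≤ ‖f‖ :=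
  norm_condExpL2_coe_le (A.fieldOf_le E) f

variable [IsProbabilityMeasure P]

theorem coeFn_proj (E : Set ℝ) (f : Lp 𝕜 2 P) :
    (A.proj 𝕜 E f : Ω → 𝕜) =ᵐ[P] P[(f : Ω → 𝕜)|A.fieldOf E] := by
  have := (Lp.memLp f).condExpL2_ae_eq_condExp (𝕜 := 𝕜) (A.fieldOf_le E)
  rwa [Lp.toLp_coeFn] at this

theorem proj_congr {E E' : Set ℝ} (h : A.fieldOf E = A.fieldOf E') :
    A.proj 𝕜 E = A.proj 𝕜 E' := by
  ext1 f
  refine Lp.ext ((A.coeFn_proj E f).trans ?_)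
  rw [h]
  exact (A.coeFn_proj E' f).symm

theorem proj_eq_of_setIntegral_eq {E : Set ℝ} {f g : Lp 𝕜 2 P}
    (hg : AEStronglyMeasurable[A.fieldOf E] g P)
    (h : ∀ B, MeasurableSet[A.fieldOf E] B → ∫ x in B, g x ∂P = ∫ x in B, f x ∂P) :
    A.proj 𝕜 E f = g := by
  refine Lp.ext ((A.coeFn_proj E f).trans ?_)
  exact (ae_eq_condExp_of_forall_setIntegral_eq (A.fieldOf_le E) (Lp.integrable_two f)
    (fun s _ _ => (Lp.integrable_two g).integrableOn) (fun B hB _ => h B hB) hg).symm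

theorem setIntegral_proj (E : Set ℝ) (f : Lp 𝕜 2 P) {B : Set Ω}
    (hB : MeasurableSet[A.fieldOf E] B) : ∫ x in B, A.proj 𝕜 E f x ∂P = ∫ x in B, f x ∂P := by
  rw [← setIntegral_condExp (A.fieldOf_le E) (Lp.integrable_two f) hB]
  exact integral_congr_ae (ae_restrict_of_ae (A.coeFn_proj E f))

theorem proj_univ (f : Lp 𝕜 2 P) : A.proj 𝕜 univ f = f := by
  refine A.proj_eq_of_setIntegral_eq ?_ fun _ _ => rfl
  rw [A.fieldOf_univ]
  exact Lp.aestronglyMeasurable f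

/-- Conditional expectations given `F_E` and `F_E'` commute, and their product is the conditional
expectation given the sigma-field of the intersection. -/
theorem proj_proj {E : Set ℝ} (hE : (frontier E).Finite) (E' : Set ℝ)
    (f : Lp 𝕜 2 P) : A.proj 𝕜 E' (A.proj 𝕜 E f) = A.proj 𝕜 (E ∩ E') f := by
  have hf := (Lp.integrable_two f)
  have hsplit : A.fieldOf E' = A.fieldOf (E ∩ E') ⊔ A.fieldOf (E' \ E) := by
    rw [A.fieldOf_eq_sup hE E', inter_comm]
  refine Lp.ext ?_
  calc (A.proj 𝕜 E' (A.proj 𝕜 E f) : Ω → 𝕜)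
      =ᵐ[P] P[(A.proj 𝕜 E f : Ω → 𝕜)|A.fieldOf E'] := A.coeFn_proj _ _
    _ =ᵐ[P] P[P[(f : Ω → 𝕜)|A.fieldOf E]|A.fieldOf E'] := condExp_congr_ae (A.coeFn_proj _ _)
    _ =ᵐ[P] P[(f : Ω → 𝕜)|A.fieldOf (E ∩ E')] := by
      rw [hsplit]
      exact condExp_condExp_sup_of_indep (A.fieldOf_mono inter_subset_left) (A.fieldOf_le _)
        (A.fieldOf_le _) (A.indep_fieldOf hE disjoint_sdiff_right) hf
    _ =ᵐ[P] A.proj 𝕜 (E ∩ E') f := (A.coeFn_proj _ _).symm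

theorem proj_proj_self {E : Set ℝ} (hE : (frontier E).Finite) (f : Lp 𝕜 2 P) :
    A.proj 𝕜 E (A.proj 𝕜 E f) = A.proj 𝕜 E f := by
  rw [A.proj_proj hE E, inter_self]

theorem norm_sq_eq_add (f : Lp 𝕜 2 P) {E : Set ℝ} (hE : (frontier E).Finite) :
    ‖f‖ ^ 2 = ‖A.proj 𝕜 E f‖ ^ 2 + ‖f - A.proj 𝕜 E f‖ ^ 2 := by
  have h : inner 𝕜 (A.proj 𝕜 E f) (f - A.proj 𝕜 E f) = 0 := by
    rw [A.inner_proj_left, map_sub, A.proj_proj_self hE, sub_self, inner_zero_right]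
  have := norm_add_sq_eq_norm_sq_add_norm_sq_of_inner_eq_zero _ _ h
  rw [add_sub_cancel] at this
  simpa [sq] using this

theorem eLpNorm_condExp_sq (E : Set ℝ) (f : Lp 𝕜 2 P) :
    eLpNorm (P[(f : Ω → 𝕜)|A.fieldOf E]) 2 P ^ 2 = ENNReal.ofReal (‖A.proj 𝕜 E f‖ ^ 2) := by
  rw [← eLpNorm_congr_ae (A.coeFn_proj E f), Lp.norm_def, ENNReal.ofReal_pow (by positivity),
    ENNReal.ofReal_toReal (Lp.eLpNorm_ne_top _)]

/-- Projections onto increasing subspaces converge strongly. The limit is `F_E`-measurable and has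
the same projection as `f` for each `D k`; so its integrals agree with those of `f` on the pi-system
of all events of the `F_{D k}`, which identifies it. -/
theorem tendsto_proj {D : ℕ → Set ℝ} {E : Set ℝ} (hD : Monotone D)
    (hDfin : ∀ k, (frontier (D k)).Finite) (hDE : ∀ k, D k ⊆ E)
    (hgen : A.fieldOf E ≤ ⨆ k, A.fieldOf (D k)) (f : Lp 𝕜 2 P) :
    Tendsto (fun k => A.proj 𝕜 (D k) f) atTop (𝓝 (A.proj 𝕜 E f)) := by
  have : ∀ k, Fact (A.fieldOf (D k) ≤ mΩ) := fun k => ⟨A.fieldOf_le _⟩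
  have hmono : Monotone fun k => lpMeas 𝕜 𝕜 (A.fieldOf (D k)) 2 P := by
    intro j k hjk g hg
    rw [mem_lpMeas_iff_aestronglyMeasurable] at hg ⊢
    exact hg.mono (A.fieldOf_mono (hD hjk))
  obtain ⟨w, hw⟩ : ∃ w, Tendsto (fun k => A.proj 𝕜 (D k) f) atTop (𝓝 w) :=
    ⟨_, Submodule.starProjection_tendsto_closure_iSup _ hmono f⟩
  suffices A.proj 𝕜 E f = w by rwa [this]
  have hwE : AEStronglyMeasurable[A.fieldOf E] w P := by
    have hcl := isClosed_aestronglyMeasurable (F := 𝕜) (p := 2) (μ := P) (A.fieldOf_le E)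
    exact hcl.mem_of_tendsto hw (Eventually.of_forall fun k =>
      (A.aestronglyMeasurable_proj (D k) f).mono (A.fieldOf_mono (hDE k)))
  have hwk : ∀ k, A.proj 𝕜 (D k) w = A.proj 𝕜 (D k) f := by
    intro k
    refine tendsto_nhds_unique (((A.proj 𝕜 (D k)).continuous.tendsto w).comp hw) ?_
    refine tendsto_const_nhds.congr' ?_
    filter_upwards [eventually_ge_atTop k] with j hj
    rw [Function.comp_apply, A.proj_proj (hDfin j), inter_eq_right.2 (hD hj)]
  have hk : ∀ k B, MeasurableSet[A.fieldOf (D k)] B →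
      ∫ x in B, (w x - f x) ∂P = 0 := by
    intro k B hB
    rw [integral_sub (Lp.integrable_two w).integrableOn (Lp.integrable_two f).integrableOn,
      ← A.setIntegral_proj (D k) w hB, ← A.setIntegral_proj (D k) f hB, hwk, sub_self]
  refine A.proj_eq_of_setIntegral_eq hwE fun B hB => ?_
  rw [← sub_eq_zero, ← integral_sub (Lp.integrable_two w).integrableOn (Lp.integrable_two f).integrableOn]
  refine setIntegral_eq_zero_of_isPiSystem (iSup_le fun k => A.fieldOf_le (D k))
    (MeasurableSpace.generateFrom_iUnion_measurableSet _).symm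
    (isPiSystem_iUnion_of_monotone _
      (fun k => (@MeasurableSpace.isPiSystem_measurableSet Ω (A.fieldOf (D k))))
      fun j k hjk B hB => A.fieldOf_mono (hD hjk) _ hB)
    ((Lp.integrable_two w).sub (Lp.integrable_two f)) ?_ ?_ (hgen _ hB)
  · simpa using hk 0 univ MeasurableSet.univ
  · intro B hB
    obtain ⟨k, hB⟩ := mem_iUnion.1 hB
    exact hk k B hB

end ContinuousFactorization

/-! ### Inner and outer approximation of sets with finite frontier -/

section Approximation

/-- The set `E` with small open balls around its frontier points removed. -/
def innerApprox (E : Set ℝ) (k : ℕ) : Set ℝ :=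
  E \ ⋃ t ∈ frontier E, Metric.ball t (1 / (k + 1))

theorem innerApprox_subset (E : Set ℝ) (k : ℕ) : innerApprox E k ⊆ E := sdiff_subset

theorem monotone_innerApprox (E : Set ℝ) : Monotone (innerApprox E) := fun _ _ h =>
  sdiff_subset_sdiff_right
    (iUnion₂_mono fun _ _ => Metric.ball_subset_ball (Nat.one_div_le_one_div h))

/-- A point of `closure E` outside `E` is a frontier point and is removed with its own ball, so `E`
may be replaced by its closure. -/
theorem isClosed_innerApprox (E : Set ℝ) (k : ℕ) : IsClosed (innerApprox E k) := by
  have h : innerApprox E k = closure E \ ⋃ t ∈ frontier E, Metric.ball t (1 / (k + 1)) := by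
    refine subset_antisymm (sdiff_subset_sdiff_left subset_closure) fun x hx => ⟨?_, hx.2⟩
    by_contra hxE
    refine hx.2 (mem_iUnion₂.2 ⟨x, ⟨hx.1, fun h => hxE (interior_subset h)⟩, ?_⟩)
    exact Metric.mem_ball_self Nat.one_div_pos_of_nat
  rw [h]
  exact isClosed_closure.sdiff (isOpen_biUnion fun _ _ => Metric.isOpen_ball)

theorem finite_frontier_innerApprox {E : Set ℝ} (hE : (frontier E).Finite) (k : ℕ) :
    (frontier (innerApprox E k)).Finite :=
  finite_frontier_diff hE (finite_frontier_biUnion hE fun t _ => by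
    rw [Real.ball_eq_Ioo]
    exact finite_frontier_of_ordConnected ordConnected_Ioo)

end Approximation

namespace ContinuousFactorization

variable {𝕜 : Type*} [RCLike 𝕜] {Ω : Type*} [mΩ : MeasurableSpace Ω] {P : Measure Ω}
  (A : ContinuousFactorization P)

/-- Here condition (ii) enters: an interval shrunk inside `(s, t) ⊆ E` keeps a positive distance
from the frontier of `E`. -/
theorem fieldOf_le_iSup_innerApprox (E : Set ℝ) :
    A.fieldOf E ≤ ⨆ k, A.fieldOf (innerApprox E k) := by
  refine A.fieldOf_le_iff.2 fun s t hst h => ?_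
  rw [← A.inner_generates s t hst]
  refine iSup_le fun ε => iSup_le fun hε => iSup_le fun hle => ?_
  -- Half of the margin pays for the radius of the balls; the other half keeps the interval
  -- nondegenerate when `s + ε = t - ε`.
  obtain ⟨k, hk⟩ := exists_nat_one_div_lt (half_pos hε)
  refine le_trans (A.F_mono (r := s + ε / 2) (u := t - ε / 2) (by linarith) hle (by linarith)) ?_
  refine le_iSup_of_le k (A.F_le_fieldOf (by linarith) fun x hx => ⟨h ⟨?_, ?_⟩, fun hxU => ?_⟩)
  · linarith [hx.1]
  · linarith [hx.2]
  · obtain ⟨y, hyE, hy⟩ := mem_iUnion₂.1 hxU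
    rw [Real.ball_eq_Ioo] at hy
    have hyst : y ∈ Ioo s t := ⟨by linarith [hy.2, hx.1], by linarith [hy.1, hx.2]⟩
    exact hyE.2 (interior_maximal h isOpen_Ioo hyst)

variable [IsProbabilityMeasure P]

theorem tendsto_proj_innerApprox {E : Set ℝ} (hE : (frontier E).Finite) (f : Lp 𝕜 2 P) :
    Tendsto (fun k => A.proj 𝕜 (innerApprox E k) f) atTop (𝓝 (A.proj 𝕜 E f)) :=
  A.tendsto_proj (monotone_innerApprox E) (finite_frontier_innerApprox hE) (innerApprox_subset E)
    (A.fieldOf_le_iSup_innerApprox E) f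

/-- The sets `E ∪ innerApprox Eᶜ k` generate everything in the limit, and each meets `(innerApprox
Eᶜ k)ᶜ` exactly in `E`. So the error is at most the distance from `f` to its projection for `E ∪
innerApprox Eᶜ k`. -/
theorem tendsto_proj_compl_innerApprox_compl {E : Set ℝ} (hE : (frontier E).Finite)
    (f : Lp 𝕜 2 P) :
    Tendsto (fun k => A.proj 𝕜 (innerApprox Eᶜ k)ᶜ f) atTop (𝓝 (A.proj 𝕜 E f)) := by
  have hfin : ∀ k, (frontier (innerApprox Eᶜ k)).Finite :=
    finite_frontier_innerApprox (finite_frontier_compl hE)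
  have h : Tendsto (fun k => A.proj 𝕜 (E ∪ innerApprox Eᶜ k) f) atTop (𝓝 f) := by
    have := A.tendsto_proj (D := fun k => E ∪ innerApprox Eᶜ k) (E := univ)
      (fun _ _ hjk => union_subset_union_right _ (monotone_innerApprox _ hjk))
      (fun k => finite_frontier_union hE (hfin k)) (fun _ => subset_univ _) ?_ f
    · rwa [A.proj_univ] at this
    · rw [A.fieldOf_eq_sup hE univ, univ_inter, ← compl_eq_univ_sdiff]
      refine sup_le (le_iSup_of_le 0 (A.fieldOf_mono subset_union_left)) ?_
      exact (A.fieldOf_le_iSup_innerApprox _).trans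
        (iSup_mono fun k => A.fieldOf_mono subset_union_right)
  rw [tendsto_iff_norm_sub_tendsto_zero] at h ⊢
  refine squeeze_zero (fun _ => norm_nonneg _) (fun k => ?_) h
  have hproj : A.proj 𝕜 (innerApprox Eᶜ k)ᶜ (A.proj 𝕜 (E ∪ innerApprox Eᶜ k) f)
      = A.proj 𝕜 E f := by
    rw [A.proj_proj (finite_frontier_union hE (hfin k))]
    congr 2
    ext x
    have : x ∈ innerApprox Eᶜ k → x ∉ E := fun hx => innerApprox_subset _ _ hx
    simp only [mem_inter_iff, mem_union, mem_compl_iff]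
    tauto
  rw [← hproj, ← map_sub, norm_sub_rev (A.proj 𝕜 (E ∪ innerApprox Eᶜ k) f)]
  exact A.norm_proj_le _ _

/-! ### Discrete measures for finite families of commuting projections -/

/-- The weight of `S` is the squared norm of the component of `f` killed by the projections with
index in `S` and fixed by the others. The induction splits `f` into `proj (D i) f` and its
orthogonal remainder. -/
theorem exists_weights {ι : Type*} [DecidableEq ι] {D : ι → Set ℝ}
    (hD : ∀ i, (frontier (D i)).Finite) (I : Finset ι) (f : Lp 𝕜 2 P) :
    ∃ w : Finset ι → ℝ≥0∞, ∀ J ⊆ I,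
      ∑ S ∈ I.powerset, (if Disjoint S J then w S else 0)
        = ENNReal.ofReal (‖A.proj 𝕜 (⋂ i ∈ J, D i) f‖ ^ 2) := by
  induction I using Finset.induction_on generalizing f with
  | empty =>
    refine ⟨fun _ => ENNReal.ofReal (‖f‖ ^ 2), fun J hJ => ?_⟩
    rw [Finset.subset_empty.1 hJ]
    simp [A.proj_univ]
  | insert i I hi ih =>
    obtain ⟨w₁, h₁⟩ := ih (A.proj 𝕜 (D i) f)
    obtain ⟨w₂, h₂⟩ := ih (f - A.proj 𝕜 (D i) f)
    refine ⟨fun S => if i ∈ S then w₂ (S.erase i) else w₁ S, fun J hJ => ?_⟩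
    rw [Finset.sum_powerset_insert hi]
    have e₁ : ∑ S ∈ I.powerset,
        (if Disjoint S J then (if i ∈ S then w₂ (S.erase i) else w₁ S) else 0)
        = ∑ S ∈ I.powerset, (if Disjoint S (J.erase i) then w₁ S else 0) := by
      refine Finset.sum_congr rfl fun S hS => ?_
      have hiS : i ∉ S := fun h => hi (Finset.mem_powerset.1 hS h)
      rw [if_neg hiS]
      congr 1
      rw [eq_iff_iff, ← Finset.disjoint_erase_comm, Finset.erase_eq_of_notMem hiS]
    have e₂ : ∑ S ∈ I.powerset, (if Disjoint (insert i S) J then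
          (if i ∈ insert i S then w₂ ((insert i S).erase i) else w₁ (insert i S)) else 0)
        = ∑ S ∈ I.powerset, (if i ∉ J ∧ Disjoint S J then w₂ S else 0) := by
      refine Finset.sum_congr rfl fun S hS => ?_
      have hiS : i ∉ S := fun h => hi (Finset.mem_powerset.1 hS h)
      rw [if_pos (Finset.mem_insert_self i S), Finset.erase_insert hiS]
      simp only [Finset.disjoint_insert_left]
    have hJ' : J.erase i ⊆ I := fun x hx =>
      (Finset.mem_insert.1 (hJ (Finset.mem_of_mem_erase hx))).resolve_left (Finset.ne_of_mem_erase hx)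
    rw [e₁, e₂, h₁ _ hJ', A.proj_proj (hD i)]
    by_cases hiJ : i ∈ J
    · simp only [hiJ, not_true_eq_false, false_and, if_false, Finset.sum_const_zero, add_zero]
      conv_rhs => rw [← Finset.insert_erase hiJ, Finset.set_biInter_insert]
    · rw [Finset.erase_eq_of_notMem hiJ] at hJ' ⊢
      simp only [hiJ, not_false_eq_true, true_and]
      have hfin : (frontier (⋂ j ∈ J, D j)).Finite := by
        rw [← compl_compl (⋂ j ∈ J, D j)]
        refine finite_frontier_compl ?_
        simp only [compl_iInter]
        exact finite_frontier_biUnion J.finite_toSet fun j _ => finite_frontier_compl (hD j)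
      rw [h₂ _ hJ', ← ENNReal.ofReal_add (by positivity) (by positivity),
        A.norm_sq_eq_add (A.proj 𝕜 (⋂ j ∈ J, D j) f) (hD i), map_sub, A.proj_proj (hD i),
        A.proj_proj hfin, inter_comm]

/-- For a finite set `T` there is a measure on the space of compact sets that has the values
prescribed for the spectral measure on all sets with frontier in `T`. -/
theorem exists_measure_of_frontier_subset (T : Finset ℝ) {N : ℝ} (hN0 : 0 ≤ N)
    (hN : ∀ t ∈ T, |t| ≤ N) (f : Lp 𝕜 2 P) :
    ∃ μ : Measure (Compacts ℝ),
      (∀ E : Set ℝ, frontier E ⊆ T →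
        μ {M | (M : Set ℝ) ⊆ E} = ENNReal.ofReal (‖A.proj 𝕜 E f‖ ^ 2)) ∧
      ∀ r, N + 1 ≤ r → μ {M | (M : Set ℝ) ⊆ Icc (-r) r}ᶜ = 0 := by
  classical
  -- Off `T`, the set of cut points to the left of `x` labels the component of `Tᶜ` that contains
  -- `x`; `cell L` is the component with label `L`, possibly empty.
  set c : ℝ → Finset ℝ := fun x => T.filter (· < x) with hc
  set cell : Finset ℝ → Set ℝ := fun L => {x | x ∉ T ∧ c x = L} with hcell
  have hnear : ∀ x ∉ T, ∀ᶠ y in 𝓝 x, y ∉ T ∧ c y = c x := by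
    intro x hx
    have hlt : ∀ t ∈ T, ∀ᶠ y in 𝓝 x, y ≠ t ∧ (t < y ↔ t < x) := by
      intro t ht
      have hne : t ≠ x := fun h => hx (h ▸ ht)
      rcases lt_or_gt_of_ne hne with h | h
      · filter_upwards [eventually_gt_nhds h] with y hy
        exact ⟨hy.ne', iff_of_true hy h⟩
      · filter_upwards [eventually_lt_nhds h] with y hy
        exact ⟨hy.ne, iff_of_false hy.not_gt h.not_gt⟩
    filter_upwards [(Filter.eventually_all_finset T).2 hlt] with y hy
    exact ⟨fun hyT => (hy y hyT).1 rfl, Finset.filter_congr fun t ht => (hy t ht).2⟩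
  have hcellfin : ∀ L, (frontier (cell L)ᶜ).Finite := by
    intro L
    refine T.finite_toSet.subset fun x hx => ?_
    by_contra hxT
    rw [frontier_compl, frontier_eq_inter_compl_interior] at hx
    by_cases hxL : c x = L
    · refine hx.1 (mem_interior_iff_mem_nhds.2 ?_)
      filter_upwards [hnear x hxT] with y hy
      exact ⟨hy.1, hy.2.trans hxL⟩
    · refine hx.2 (mem_interior_iff_mem_nhds.2 ?_)
      filter_upwards [hnear x hxT] with y hy hyL
      exact hxL (hy.2.symm.trans hyL.2)
  have hconst : ∀ E : Set ℝ, frontier E ⊆ T → ∀ x ∉ T, ∀ y ∉ T, c x = c y → (x ∈ E ↔ y ∈ E) := by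
    intro E hE
    have aux : ∀ x ∉ T, ∀ y ∉ T, x ≤ y → c x = c y → (x ∈ E ↔ y ∈ E) := by
      intro x hx y hy hxy hcxy
      have hempty : frontier E ∩ Icc x y = ∅ := by
        refine eq_empty_of_forall_notMem fun t ht => ?_
        have htT : t ∈ T := hE ht.1
        have hty : t ∈ c y :=
          Finset.mem_filter.2 ⟨htT, lt_of_le_of_ne ht.2.2 fun h => hy (h ▸ htT)⟩
        rw [← hcxy] at hty
        exact absurd (Finset.mem_filter.1 hty).2 ht.2.1.not_gt
      rcases isPreconnected_Icc.subset_or_disjoint_of_frontier hempty with h | h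
      · exact iff_of_true (h (left_mem_Icc.2 hxy)) (h (right_mem_Icc.2 hxy))
      · exact iff_of_false (disjoint_left.1 h (left_mem_Icc.2 hxy))
          (disjoint_left.1 h (right_mem_Icc.2 hxy))
    intro x hx y hy hcxy
    rcases le_total x y with h | h
    · exact aux x hx y hy h hcxy
    · exact (aux y hy x hx h hcxy.symm).symm
  -- A cell with a point beyond `N + 1` in absolute value contains `N + 1` or `-(N + 1)`. Bounded
  -- representatives give the support bound needed for tightness.
  have hrep : ∀ L, (cell L).Nonempty → ∃ r ∈ cell L, |r| ≤ N + 1 := by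
    rintro L ⟨x, hxT, hxL⟩
    have hout : ∀ y, N < |y| → y ∉ T := fun y hy hyT => (hN y hyT).not_gt hy
    by_cases hx : |x| ≤ N + 1
    · exact ⟨x, ⟨hxT, hxL⟩, hx⟩
    rw [not_le, lt_abs] at hx
    rcases hx with hx | hx
    · have habs : |N + 1| = N + 1 := abs_of_nonneg (by linarith)
      refine ⟨N + 1, ⟨hout _ (by rw [habs]; linarith), ?_⟩, habs.le⟩
      rw [← hxL]
      refine Finset.filter_congr fun t ht => iff_of_true ?_ ?_ <;>
        linarith [hN t ht, le_abs_self t]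
    · have habs : |-(N + 1)| = N + 1 := by rw [abs_neg]; exact abs_of_nonneg (by linarith)
      refine ⟨-(N + 1), ⟨hout _ (by rw [habs]; linarith), ?_⟩, habs.le⟩
      rw [← hxL]
      refine Finset.filter_congr fun t ht => iff_of_false ?_ ?_ <;>
        linarith [hN t ht, neg_abs_le t]
  choose! rep hrepmem hrepN using hrep
  obtain ⟨w, hw⟩ := A.exists_weights hcellfin T.powerset f
  set pts : Finset (Finset ℝ) → Set ℝ :=
    fun S => rep '' {L | L ∈ S ∧ (cell L).Nonempty} with hpts
  have hptsfin : ∀ S, (pts S).Finite := fun S =>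
    (S.finite_toSet.subset fun L hL => hL.1).image rep
  set K : Finset (Finset ℝ) → Compacts ℝ := fun S => ⟨pts S, (hptsfin S).isCompact⟩ with hK
  have hKcoe : ∀ S, (K S : Set ℝ) = pts S := fun _ => rfl
  refine ⟨∑ S ∈ T.powerset.powerset, w S • Measure.dirac (K S), fun E hE => ?_, fun r hr => ?_⟩
  -- Removing the cells whose representative misses `E` leaves `E` up to points of `T`.
  · set J : Finset (Finset ℝ) :=
      T.powerset.filter fun L => (cell L).Nonempty ∧ rep L ∉ E with hJ
    have hJE : A.fieldOf (⋂ L ∈ J, (cell L)ᶜ) = A.fieldOf E := by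
      refine A.fieldOf_congr T.finite_toSet ?_
      ext x
      simp only [Set.mem_sdiff, mem_iInter, mem_compl_iff, Finset.mem_coe]
      refine and_congr_left fun hxT => ⟨fun h => ?_, fun hxE L hL hxL => ?_⟩
      · by_contra hxE
        have hx : x ∈ cell (c x) := ⟨hxT, rfl⟩
        have hr := hrepmem _ ⟨x, hx⟩
        refine h (c x) (Finset.mem_filter.2 ⟨Finset.mem_powerset.2 (Finset.filter_subset _ _),
          ⟨x, hx⟩, fun hrE => hxE ?_⟩) hx
        exact (hconst E hE x hxT _ hr.1 hr.2.symm).2 hrE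
      · obtain ⟨-, hne, hrE⟩ := Finset.mem_filter.1 hL
        have hr := hrepmem L hne
        exact hrE ((hconst E hE x hxT _ hr.1 (hxL.2.trans hr.2.symm)).1 hxE)
    rw [← A.proj_congr hJE, ← hw J (Finset.filter_subset _ _), Measure.finsetSum_apply]
    refine Finset.sum_congr rfl fun S hS => ?_
    have hiff : K S ∈ {M : Compacts ℝ | (M : Set ℝ) ⊆ E} ↔ Disjoint S J := by
      rw [mem_ofPred_eq, hKcoe, hpts, image_subset_iff, Finset.disjoint_left]
      refine ⟨fun h L hLS hLJ => ?_, fun h L hL => ?_⟩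
      · obtain ⟨-, hne, hrE⟩ := Finset.mem_filter.1 hLJ
        exact hrE (h ⟨hLS, hne⟩)
      · by_contra hrE
        exact h hL.1 (Finset.mem_filter.2 ⟨Finset.mem_powerset.1 hS hL.1, hL.2, hrE⟩)
    rw [Measure.smul_apply, Measure.dirac_apply, smul_eq_mul]
    by_cases h : Disjoint S J
    · rw [if_pos h, indicator_of_mem (hiff.2 h), Pi.one_apply, mul_one]
    · rw [if_neg h, indicator_of_notMem (fun hh => h (hiff.1 hh)), mul_zero]
  · rw [Measure.finsetSum_apply]
    refine Finset.sum_eq_zero fun S _ => ?_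
    rw [Measure.smul_apply, Measure.dirac_apply, indicator_of_notMem, smul_zero]
    rw [notMem_compl_iff, mem_ofPred_eq, hKcoe]
    rintro _ ⟨L, hL, rfl⟩
    exact abs_le.1 ((hrepN L hL.2).trans hr)

end ContinuousFactorization

/-! ### The Borel sigma-algebra of the space of compact sets -/

section BorelCompacts

/-- The condition is closed (`M ⊆ closure E`) together with open (`M` avoids the finitely many
frontier points missing from `E`). -/
theorem measurableSet_compacts_subset {E : Set ℝ} (hE : (frontier E).Finite) :
    MeasurableSet {M : Compacts ℝ | (M : Set ℝ) ⊆ E} := by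
  have h : {M : Compacts ℝ | (M : Set ℝ) ⊆ E} = {M : Compacts ℝ | (M : Set ℝ) ⊆ closure E} ∩
      {M : Compacts ℝ | (M : Set ℝ) ⊆ (frontier E \ E)ᶜ} := by
    ext M
    refine ⟨fun hM => ⟨hM.trans subset_closure, fun x hx hx' => hx'.2 (hM hx)⟩, fun hM x hx => ?_⟩
    by_contra hxE
    exact hM.2 hx ⟨⟨hM.1 hx, fun hi => hxE (interior_subset hi)⟩, hxE⟩
  rw [h]
  exact (Compacts.isClosed_subsets_of_isClosed isClosed_closure).measurableSet.inter
    (Compacts.isOpen_subsets_of_isOpen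
      (hE.subset sdiff_subset).isClosed.isOpen_compl).measurableSet

theorem isPiSystem_compacts_subset_elementary :
    IsPiSystem {𝓜 : Set (Compacts ℝ) | ∃ E, IsElementarySet E ∧ 𝓜 = {M : Compacts ℝ | (M : Set ℝ) ⊆ E}} := by
  rintro _ ⟨E, hE, rfl⟩ _ ⟨E', hE', rfl⟩ _
  refine ⟨E ∩ E', hE.inter hE', ?_⟩
  ext M
  exact subset_inter_iff.symm

/-- A countable base of the topology consists of the conditions that `M` be covered by finitely many
rational intervals and hit each of them; hitting `U` is the negation of `M ⊆ Uᶜ`. -/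
theorem borel_compacts_eq_generateFrom : borel (Compacts ℝ) = MeasurableSpace.generateFrom
    {𝓜 : Set (Compacts ℝ) | ∃ E, IsElementarySet E ∧ 𝓜 = {M : Compacts ℝ | (M : Set ℝ) ⊆ E}} := by
  refine le_antisymm ?_ (MeasurableSpace.generateFrom_le ?_)
  · have hB := Real.isTopologicalBasis_Ioo_rat.compacts
    rw [hB.borel_eq_generateFrom]
    refine MeasurableSpace.generateFrom_le ?_
    rintro _ ⟨u, ⟨hu, huB⟩, rfl⟩
    have hord : ∀ U ∈ u, U.OrdConnected ∧ IsElementarySet Uᶜ := by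
      intro U hU
      obtain ⟨a, b, -, hab⟩ : ∃ a b : ℚ, a < b ∧ U = Ioo (a : ℝ) b := by simpa using huB hU
      rw [hab, show (Ioo (a : ℝ) b)ᶜ = Iic (a : ℝ) ∪ Ici (b : ℝ) from by
        ext x; simp only [mem_compl_iff, mem_Ioo, not_and_or, not_lt, mem_union, mem_Iic, mem_Ici]]
      exact ⟨ordConnected_Ioo, ordConnected_Iic.isElementarySet.union ordConnected_Ici.isElementarySet⟩
    have h : {M : Compacts ℝ | (M : Set ℝ) ⊆ ⋃₀ u ∧ ∀ U ∈ u, ((M : Set ℝ) ∩ U).Nonempty}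
        = {M : Compacts ℝ | (M : Set ℝ) ⊆ ⋃₀ u} ∩ ⋂ U ∈ u, {M : Compacts ℝ | (M : Set ℝ) ⊆ Uᶜ}ᶜ := by
      ext M
      simp only [mem_ofPred_eq, mem_inter_iff, mem_iInter, mem_compl_iff, subset_compl_iff_disjoint_right,
        not_disjoint_iff_nonempty_inter]
    beta_reduce
    rw [h]
    refine MeasurableSet.inter
      (MeasurableSpace.measurableSet_generateFrom ⟨_, ⟨u, hu, fun U hU => (hord U hU).1, rfl⟩, rfl⟩)
      (MeasurableSet.biInter hu.countable fun U hU => MeasurableSet.compl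
        (MeasurableSpace.measurableSet_generateFrom ⟨_, (hord U hU).2, rfl⟩))
  · rintro _ ⟨E, hE, rfl⟩
    exact measurableSet_compacts_subset hE.finite_frontier

/-- A finite measure on the space of compact sets is determined by its values on the sets
`{M | M ⊆ E}` with elementary `E`. -/
theorem MeasureTheory.Measure.ext_of_compacts_subset {μ ν : Measure (Compacts ℝ)}
    [IsFiniteMeasure μ]
    (h : ∀ E, IsElementarySet E → μ {M | (M : Set ℝ) ⊆ E} = ν {M | (M : Set ℝ) ⊆ E}) : μ = ν := by
  refine ext_of_generate_finite _ borel_compacts_eq_generateFrom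
    isPiSystem_compacts_subset_elementary ?_ ?_
  · rintro _ ⟨E, hE, rfl⟩
    exact h E hE
  · simpa using h univ ordConnected_univ.isElementarySet

end BorelCompacts

namespace ContinuousFactorization

variable {𝕜 : Type*} [RCLike 𝕜] {Ω : Type*} [mΩ : MeasurableSpace Ω] {P : Measure Ω}
  (A : ContinuousFactorization P) [IsProbabilityMeasure P]

/-! ### Existence and uniqueness of spectral measures -/

theorem tendsto_proj_Icc (f : Lp 𝕜 2 P) :
    Tendsto (fun n : ℕ => A.proj 𝕜 (Icc (-(n : ℝ)) n) f) atTop (𝓝 f) := by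
  have h := A.tendsto_proj (D := fun n : ℕ => Icc (-(n : ℝ)) n) (E := univ) (fun j k hjk => ?_)
    (fun n => finite_frontier_of_ordConnected ordConnected_Icc) (fun _ => subset_univ _) ?_ f
  · rwa [A.proj_univ] at h
  · have : (j : ℝ) ≤ k := Nat.cast_le.2 hjk
    exact Icc_subset_Icc (neg_le_neg this) this
  · refine A.fieldOf_le_iff.2 fun s t hst _ => ?_
    obtain ⟨n, hn⟩ := exists_nat_gt (max |s| |t|)
    refine le_iSup_of_le n (A.F_le_fieldOf hst (Ioo_subset_Icc_self.trans (Icc_subset_Icc ?_ ?_)))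
    · linarith [neg_abs_le s, (le_max_left |s| |t|).trans hn.le]
    · linarith [le_abs_self t, (le_max_right |s| |t|).trans hn.le]

/-- A finite measure with the right total mass that bounds `‖𝔼 (f | F_E)‖²` from below for open
and from above for closed sets `E`. -/
theorem exists_measure_open_le_closed_ge (f : Lp 𝕜 2 P) :
    ∃ μ : Measure (Compacts ℝ), IsFiniteMeasure μ ∧
      (∀ E : Set ℝ, (frontier E).Finite → IsOpen E →
        μ {M | (M : Set ℝ) ⊆ E} ≤ ENNReal.ofReal (‖A.proj 𝕜 E f‖ ^ 2)) ∧
      ∀ E : Set ℝ, (frontier E).Finite → IsClosed E →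
        ENNReal.ofReal (‖A.proj 𝕜 E f‖ ^ 2) ≤ μ {M | (M : Set ℝ) ⊆ E} := by
  classical
  have hstage : ∀ T : Finset ℝ, ∃ μ : Measure (Compacts ℝ),
      (∀ E : Set ℝ, frontier E ⊆ T →
        μ {M | (M : Set ℝ) ⊆ E} = ENNReal.ofReal (‖A.proj 𝕜 E f‖ ^ 2)) ∧
      ∀ n : ℕ, μ {M | (M : Set ℝ) ⊆ Icc (-(n : ℝ)) n}ᶜ
        ≤ ENNReal.ofReal (‖f‖ ^ 2 - ‖A.proj 𝕜 (Icc (-(n : ℝ)) n) f‖ ^ 2) := by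
    intro T
    obtain ⟨N, hN⟩ : ∃ N : ℕ, ∀ t ∈ T, |t| ≤ N := by
      obtain ⟨N, hN⟩ := exists_nat_ge (∑ t ∈ T, |t|)
      exact ⟨N, fun t ht =>
        (Finset.single_le_sum (f := fun t : ℝ => |t|) (fun _ _ => abs_nonneg _) ht).trans hN⟩
    -- With the points `±n`, `n ≤ N`, as extra cuts, the tail bound for these `n` comes from exact
    -- values; for `n ≥ N + 1` the tail is zero by the support bound.
    set T' : Finset ℝ := T ∪ (Finset.range (N + 1)).biUnion fun n => {-(n : ℝ), (n : ℝ)} with hT'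
    have hN' : ∀ t ∈ T', |t| ≤ N := by
      intro t ht
      rcases Finset.mem_union.1 ht with h | h
      · exact hN t h
      · obtain ⟨n, hn, h⟩ := Finset.mem_biUnion.1 h
        have hnN : (n : ℝ) ≤ N := Nat.cast_le.2 (Nat.lt_succ_iff.1 (Finset.mem_range.1 hn))
        rcases Finset.mem_insert.1 h with h | h
        · rwa [h, abs_neg, Nat.abs_cast]
        · rwa [Finset.mem_singleton.1 h, Nat.abs_cast]
    obtain ⟨μ, h₁, h₂⟩ := A.exists_measure_of_frontier_subset T' (Nat.cast_nonneg N) hN' f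
    refine ⟨μ, fun E hE => h₁ E (hE.trans ?_), fun n => ?_⟩
    · exact Finset.coe_subset.2 Finset.subset_union_left
    · have hn0 : -(n : ℝ) ≤ n := by linarith [Nat.cast_nonneg (α := ℝ) n]
      rcases le_or_gt n N with hn | hn
      · have hfr : frontier (Icc (-(n : ℝ)) n) ⊆ T' := by
          rw [frontier_Icc hn0]
          intro t ht
          refine Finset.mem_coe.2 (Finset.mem_union_right _ (Finset.mem_biUnion.2
            ⟨n, Finset.mem_range.2 (Nat.lt_succ_of_le hn), ?_⟩))
          simpa using ht
        have hu : μ univ = ENNReal.ofReal (‖f‖ ^ 2) := by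
          have := h₁ univ (by simp)
          simpa [A.proj_univ] using this
        rw [measure_compl (measurableSet_compacts_subset
            (finite_frontier_of_ordConnected ordConnected_Icc)), h₁ _ hfr, hu,
          ENNReal.ofReal_sub _ (by positivity)]
        rw [h₁ _ hfr]
        exact ENNReal.ofReal_ne_top
      · rw [h₂ n (by exact_mod_cast hn)]
        exact zero_le
  choose m hm₁ hm₂ using hstage
  have hmuniv : ∀ T, m T univ = ENNReal.ofReal (‖f‖ ^ 2) := by
    intro T
    have := hm₁ T univ (by simp)
    simpa [A.proj_univ] using this
  have hmfin : ∀ T, IsFiniteMeasure (m T) := fun T =>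
    ⟨by rw [hmuniv]; exact ENNReal.ofReal_lt_top⟩
  set μs : Finset ℝ → FiniteMeasure (Compacts ℝ) := fun T => ⟨m T, hmfin T⟩ with hμs
  -- This tail bound does not depend on `T` and tends to zero, so the family is tight.
  set u : ℕ → NNReal :=
    fun n => Real.toNNReal (‖f‖ ^ 2 - ‖A.proj 𝕜 (Icc (-(n : ℝ)) n) f‖ ^ 2) with hu
  have hu0 : Tendsto u atTop (𝓝 0) := by
    have h₁ := ((A.tendsto_proj_Icc f).norm.pow 2).const_sub (‖f‖ ^ 2)
    rw [sub_self] at h₁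
    have h₂ := (continuous_real_toNNReal.tendsto 0).comp h₁
    rwa [Real.toNNReal_zero] at h₂
  have hcompact := isCompact_setOfPred_finiteMeasure_mass_eq_compl_isCompact_le
    (E := Compacts ℝ) (K := fun n : ℕ => {M | (M : Set ℝ) ⊆ Icc (-(n : ℝ)) n})
    (Real.toNNReal (‖f‖ ^ 2)) hu0 (fun n => Compacts.isCompact_subsets_of_isCompact isCompact_Icc)
    (Or.inr fun j k hjk M hM => Subset.trans hM (by
      have : (j : ℝ) ≤ k := Nat.cast_le.2 hjk
      exact Icc_subset_Icc (neg_le_neg this) this))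
  have hmem : ∀ T, μs T ∈ {μ : FiniteMeasure (Compacts ℝ) | μ.mass = Real.toNNReal (‖f‖ ^ 2) ∧
      ∀ n : ℕ, μ {M : Compacts ℝ | (M : Set ℝ) ⊆ Icc (-(n : ℝ)) n}ᶜ ≤ u n} := by
    refine fun T => ⟨?_, fun n => ?_⟩
    · rw [← ENNReal.coe_inj, FiniteMeasure.ennreal_mass]
      exact hmuniv T
    · rw [← ENNReal.coe_le_coe, FiniteMeasure.ennreal_coeFn_eq_coeFn_toMeasure]
      exact hm₂ T n
  -- Along an ultrafilter finer than `atTop` the measures converge, and for each fixed `E` they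
  -- eventually have the exact value.
  set U : Ultrafilter (Finset ℝ) := Ultrafilter.of atTop with hU
  have hUle : (U : Filter (Finset ℝ)) ≤ atTop := Ultrafilter.of_le _
  obtain ⟨μ, ⟨hμmass, -⟩, hμlim⟩ := hcompact.ultrafilter_le_nhds (U.map μs)
    (le_principal_iff.2 (Ultrafilter.mem_map.2 (univ_mem' hmem)))
  have hlim : Tendsto μs U (𝓝 μ) := hμlim
  have hμuniv : (μ : Measure (Compacts ℝ)) univ = ENNReal.ofReal (‖f‖ ^ 2) := by
    rw [← FiniteMeasure.ennreal_mass, hμmass]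
    rfl
  have hev : ∀ E : Set ℝ, (frontier E).Finite →
      ∀ᶠ T : Finset ℝ in (U : Filter (Finset ℝ)), frontier E ⊆ (T : Set ℝ) := by
    intro E hE
    refine hUle (mem_of_superset (mem_atTop hE.toFinset) fun T hT x hx => ?_)
    exact hT (hE.mem_toFinset.2 hx)
  refine ⟨μ, inferInstance, fun E hE hEo => ?_, fun E hE hEc => ?_⟩
  · have hcl : IsClosed {M : Compacts ℝ | (M : Set ℝ) ⊆ E}ᶜ :=
      (Compacts.isOpen_subsets_of_isOpen hEo).isClosed_compl
    have hms := measurableSet_compacts_subset hE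
    have h := FiniteMeasure.limsup_measure_closed_le_of_tendsto hlim hcl
    rw [limsup_congr (v := fun _ => ENNReal.ofReal (‖f‖ ^ 2 - ‖A.proj 𝕜 E f‖ ^ 2)), limsup_const,
      measure_compl hms (measure_ne_top _ _), hμuniv] at h
    · have hle : (μ : Measure (Compacts ℝ)) {M | (M : Set ℝ) ⊆ E} ≤ ENNReal.ofReal (‖f‖ ^ 2) := by
        rw [← hμuniv]
        exact measure_mono (subset_univ _)
      rw [ENNReal.ofReal_sub _ (by positivity)] at h
      have h' := tsub_le_tsub_left h (ENNReal.ofReal (‖f‖ ^ 2))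
      rw [ENNReal.sub_sub_cancel ENNReal.ofReal_ne_top hle, ENNReal.sub_sub_cancel
        ENNReal.ofReal_ne_top (ENNReal.ofReal_le_ofReal (by gcongr; exact A.norm_proj_le E f))] at h'
      exact h'
    · filter_upwards [hev E hE] with T hT
      change m T _ = _
      have := hmfin T
      rw [measure_compl hms (measure_ne_top _ _), hm₁ T E hT, hmuniv,
        ENNReal.ofReal_sub _ (by positivity)]
  · have h := FiniteMeasure.limsup_measure_closed_le_of_tendsto hlim
      (Compacts.isClosed_subsets_of_isClosed hEc)
    rwa [limsup_congr (v := fun _ => ENNReal.ofReal (‖A.proj 𝕜 E f‖ ^ 2)), limsup_const] at h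
    filter_upwards [hev E hE] with T hT
    exact hm₁ T E hT

theorem exists_isSpectralMeasure (f : Lp 𝕜 2 P) :
    ∃ μ : Measure (Compacts ℝ), A.IsSpectralMeasure f μ := by
  obtain ⟨μ, hμ, hopen, hclosed⟩ := A.exists_measure_open_le_closed_ge f
  refine ⟨μ, hμ, fun E hE => ?_⟩
  have hE := hE.finite_frontier
  rw [A.eLpNorm_condExp_sq]
  refine le_antisymm ?_ ?_
  · have hlim := ENNReal.tendsto_ofReal ((A.tendsto_proj_compl_innerApprox_compl hE f).norm.pow 2)
    refine ge_of_tendsto' hlim fun k => ?_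
    refine (measure_mono fun M hM => Subset.trans hM ?_).trans
      (hopen _ (finite_frontier_compl (finite_frontier_innerApprox (finite_frontier_compl hE) k))
        (isClosed_innerApprox _ k).isOpen_compl)
    exact fun x hx hx' => innerApprox_subset _ _ hx' hx
  · have hlim := ENNReal.tendsto_ofReal ((A.tendsto_proj_innerApprox hE f).norm.pow 2)
    refine le_of_tendsto' hlim fun k => ?_
    refine (hclosed _ (finite_frontier_innerApprox hE k) (isClosed_innerApprox E k)).trans ?_
    exact measure_mono fun M hM => Subset.trans hM (innerApprox_subset E k)

theorem existsUnique_isSpectralMeasure (f : Lp 𝕜 2 P) :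
    ∃! μ : Measure (Compacts ℝ), A.IsSpectralMeasure f μ := by
  obtain ⟨μ, hμ⟩ := A.exists_isSpectralMeasure f
  refine ⟨μ, hμ, fun ν hν => ?_⟩
  have := hν.1
  exact Measure.ext_of_compacts_subset fun E hE => by rw [hν.2 E hE, hμ.2 E hE]

theorem isSpectralMeasure_spectralMeasure (f : Lp 𝕜 2 P) :
    A.IsSpectralMeasure f (A.spectralMeasure f) := by
  have h := A.exists_isSpectralMeasure f
  rw [spectralMeasure, dif_pos h]
  exact h.choose_spec

instance isFiniteMeasure_spectralMeasure (f : Lp 𝕜 2 P) :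
    IsFiniteMeasure (A.spectralMeasure f) :=
  (A.isSpectralMeasure_spectralMeasure f).1

theorem spectralMeasure_subset (f : Lp 𝕜 2 P) {E : Set ℝ} (hE : IsElementarySet E) :
    A.spectralMeasure f {M | (M : Set ℝ) ⊆ E} = ENNReal.ofReal (‖A.proj 𝕜 E f‖ ^ 2) := by
  rw [(A.isSpectralMeasure_spectralMeasure f).2 E hE, A.eLpNorm_condExp_sq]

theorem spectralMeasure_univ (f : Lp 𝕜 2 P) :
    A.spectralMeasure f univ = ENNReal.ofReal (‖f‖ ^ 2) := by
  have := A.spectralMeasure_subset f ordConnected_univ.isElementarySet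
  simpa [A.proj_univ] using this

end ContinuousFactorization

/-! ### Multiplication by indicator functions -/

namespace MeasureTheory.Lp

variable {V Ω : Type*} [NormedAddCommGroup V] {mΩ : MeasurableSpace Ω} {p : ℝ≥0∞} {P : Measure Ω}

/-- Multiplication by the indicator function of `B`. -/
noncomputable def indicatorMul {B : Set Ω} (hB : MeasurableSet B) (f : Lp V p P) : Lp V p P :=
  ((Lp.memLp f).indicator hB).toLp

theorem coeFn_indicatorMul {B : Set Ω} (hB : MeasurableSet B) (f : Lp V p P) :
    (indicatorMul hB f : Ω → V) =ᵐ[P] B.indicator f :=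
  MemLp.coeFn_toLp _

theorem indicatorMul_add {B : Set Ω} (hB : MeasurableSet B) (f g : Lp V p P) :
    indicatorMul hB (f + g) = indicatorMul hB f + indicatorMul hB g := by
  refine Lp.ext ?_
  filter_upwards [coeFn_indicatorMul hB (f + g), coeFn_indicatorMul hB f, coeFn_indicatorMul hB g,
    Lp.coeFn_add f g, Lp.coeFn_add (indicatorMul hB f) (indicatorMul hB g)] with x h₁ h₂ h₃ h₄ h₅
  rw [h₁, h₅, Pi.add_apply, h₂, h₃]
  by_cases hx : x ∈ B
  · rw [indicator_of_mem hx, indicator_of_mem hx, indicator_of_mem hx, h₄, Pi.add_apply]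
  · rw [indicator_of_notMem hx, indicator_of_notMem hx, indicator_of_notMem hx, add_zero]

theorem indicatorMul_zero {B : Set Ω} (hB : MeasurableSet B) :
    indicatorMul hB (0 : Lp V p P) = 0 := by
  have := indicatorMul_add hB (0 : Lp V p P) 0
  rwa [add_zero, left_eq_add] at this

end MeasureTheory.Lp

namespace ContinuousFactorization

open MeasureTheory.Lp

variable {𝕜 : Type*} [RCLike 𝕜] {Ω : Type*} [mΩ : MeasurableSpace Ω] {P : Measure Ω}
  (A : ContinuousFactorization P) [IsProbabilityMeasure P]

/-! ### Spectral measures and the linear structure -/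

/-- The parallelogram law for each projection. It makes the vectors not charging a given set a
subspace, without constructing spectral projections for general sets. -/
theorem spectralMeasure_add_add_sub (f g : Lp 𝕜 2 P) :
    A.spectralMeasure (f + g) + A.spectralMeasure (f - g)
      = (2 : ℝ≥0∞) • A.spectralMeasure f + (2 : ℝ≥0∞) • A.spectralMeasure g := by
  refine Measure.ext_of_compacts_subset fun E hE => ?_
  simp only [Measure.add_apply, Measure.smul_apply, A.spectralMeasure_subset _ hE, map_add, map_sub,
    smul_eq_mul]
  have h2 : ∀ x : ℝ, (2 : ℝ≥0∞) * ENNReal.ofReal x = ENNReal.ofReal (2 * x) := fun x => by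
    rw [ENNReal.ofReal_mul zero_le_two, ENNReal.ofReal_ofNat]
  rw [h2, h2, ← ENNReal.ofReal_add (by positivity) (by positivity),
    ← ENNReal.ofReal_add (by positivity) (by positivity)]
  congr 1
  have := parallelogram_law_with_norm 𝕜 (A.proj 𝕜 E f) (A.proj 𝕜 E g)
  simp only [sq]
  linarith

theorem spectralMeasure_add_le (f g : Lp 𝕜 2 P) (𝓜 : Set (Compacts ℝ)) :
    A.spectralMeasure (f + g) 𝓜 ≤ 2 * A.spectralMeasure f 𝓜 + 2 * A.spectralMeasure g 𝓜 := by
  have h := congrArg (fun μ : Measure (Compacts ℝ) => μ 𝓜) (A.spectralMeasure_add_add_sub f g)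
  simp only [Measure.add_apply, Measure.smul_apply, smul_eq_mul] at h
  rw [← h]
  exact le_self_add

theorem spectralMeasure_smul (c : 𝕜) (f : Lp 𝕜 2 P) :
    A.spectralMeasure (c • f) = ENNReal.ofReal (‖c‖ ^ 2) • A.spectralMeasure f := by
  refine Measure.ext_of_compacts_subset fun E hE => ?_
  rw [Measure.smul_apply, A.spectralMeasure_subset _ hE, A.spectralMeasure_subset _ hE, map_smul,
    norm_smul, mul_pow, ENNReal.ofReal_mul (by positivity), smul_eq_mul]

theorem spectralMeasure_zero : A.spectralMeasure (0 : Lp 𝕜 2 P) = 0 := by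
  rw [← Measure.measure_univ_eq_zero, A.spectralMeasure_univ]
  simp

theorem eq_zero_of_spectralMeasure_eq_zero {f : Lp 𝕜 2 P} (h : A.spectralMeasure f univ = 0) :
    f = 0 := by
  rw [A.spectralMeasure_univ, ENNReal.ofReal_eq_zero] at h
  exact norm_eq_zero.1 (pow_eq_zero_iff two_ne_zero |>.1 (le_antisymm h (by positivity)))

variable (𝕜) in
/-- The elements of `L₂` whose spectral measure does not charge `𝓜`. -/
def nullSubspace (𝓜 : Set (Compacts ℝ)) : Submodule 𝕜 (Lp 𝕜 2 P) where
  carrier := {f | A.spectralMeasure f 𝓜 = 0}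
  zero_mem' := by
    rw [mem_ofPred_eq, A.spectralMeasure_zero]
    rfl
  add_mem' := by
    intro f g hf hg
    rw [mem_ofPred_eq] at *
    have := A.spectralMeasure_add_le f g 𝓜
    rw [hf, hg, mul_zero, add_zero] at this
    exact le_antisymm this zero_le
  smul_mem' := by
    intro c f hf
    rw [mem_ofPred_eq] at *
    rw [A.spectralMeasure_smul, Measure.smul_apply, hf, smul_zero]

theorem mem_nullSubspace {𝓜 : Set (Compacts ℝ)} {f : Lp 𝕜 2 P} :
    f ∈ A.nullSubspace 𝕜 𝓜 ↔ A.spectralMeasure f 𝓜 = 0 := Iff.rfl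

theorem isClosed_nullSubspace (𝓜 : Set (Compacts ℝ)) :
    IsClosed (A.nullSubspace 𝕜 𝓜 : Set (Lp 𝕜 2 P)) := by
  refine isClosed_of_closure_subset fun f hf => ?_
  refine le_antisymm (ENNReal.le_of_forall_pos_le_add fun ε hε _ => ?_) zero_le
  -- The measure of `𝓜` is at most `2 * ‖f - g‖ ^ 2`, hence the radius.
  obtain ⟨g, hg, hfg⟩ := Metric.mem_closure_iff.1 hf (Real.sqrt (ε / 2))
    (Real.sqrt_pos.2 (by positivity))
  have h := A.spectralMeasure_add_le (f - g) g 𝓜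
  rw [sub_add_cancel, A.mem_nullSubspace.1 hg, mul_zero, add_zero] at h
  refine h.trans ?_
  calc 2 * A.spectralMeasure (f - g) 𝓜 ≤ 2 * A.spectralMeasure (f - g) univ := by
        gcongr
        exact subset_univ _
    _ = ENNReal.ofReal (2 * ‖f - g‖ ^ 2) := by
      rw [A.spectralMeasure_univ, ENNReal.ofReal_mul zero_le_two, ENNReal.ofReal_ofNat]
    _ ≤ ENNReal.ofReal ε := by
      refine ENNReal.ofReal_le_ofReal ?_
      rw [_root_.dist_eq_norm] at hfg
      have := (Real.lt_sqrt (norm_nonneg _)).1 hfg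
      linarith
    _ = 0 + ε := by simp

theorem spectralMeasure_compl_subset_eq_zero {f : Lp 𝕜 2 P} {E : Set ℝ} (hE : IsElementarySet E)
    (h : A.proj 𝕜 E f = f) : A.spectralMeasure f {M | (M : Set ℝ) ⊆ E}ᶜ = 0 := by
  rw [measure_compl (measurableSet_compacts_subset hE.finite_frontier) (measure_ne_top _ _),
    A.spectralMeasure_univ, A.spectralMeasure_subset f hE, h, tsub_self]

theorem spectralMeasure_subset_eq_zero {f : Lp 𝕜 2 P} {E : Set ℝ} (hE : IsElementarySet E)
    (h : A.proj 𝕜 E f = 0) : A.spectralMeasure f {M | (M : Set ℝ) ⊆ E} = 0 := by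
  rw [A.spectralMeasure_subset f hE, h]
  simp

/-! ### The first chaos -/

/-- An element of `L₂(F_{a,b})` that splits additively at every point of the interval belongs to
the first chaos. -/
theorem mem_firstChaos_of_proj_add_proj {a b : ℝ} {h : Lp 𝕜 2 P}
    (hab : A.proj 𝕜 (Ioo a b) h = h) (hempty : A.proj 𝕜 ∅ h = 0)
    (hadd : ∀ t ∈ Ioo a b, A.proj 𝕜 (Ioc a t) h + A.proj 𝕜 (Ico t b) h = h) :
    h ∈ A.firstChaos 𝕜 := by
  have hsplit : ∀ q : ℚ, A.spectralMeasure h {M | (q : ℝ) ∈ Ioo a b ∧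
      ¬ (M : Set ℝ) ⊆ Ioc a q ∧ ¬ (M : Set ℝ) ⊆ Ico q b} = 0 := by
    intro q
    by_cases hq : (q : ℝ) ∈ Ioo a b
    swap
    · simp [hq]
    have e₁ : IsElementarySet (Ioc a (q : ℝ)) := ordConnected_Ioc.isElementarySet
    have e₂ : IsElementarySet (Ico (q : ℝ) b) := ordConnected_Ico.isElementarySet
    have hinter : A.proj 𝕜 (Ioc a (q : ℝ) ∩ Ico (q : ℝ) b) h = 0 := by
      rw [← hempty]
      congr 1
      refine A.proj_congr (A.fieldOf_congr (finite_singleton (q : ℝ)) ?_)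
      ext x
      simp only [Set.mem_sdiff, mem_inter_iff, mem_Ioc, mem_Ico, mem_singleton_iff,
        mem_empty_iff_false, false_and, iff_false, not_and, not_not]
      exact fun hx => le_antisymm hx.1.2 hx.2.1
    -- Orthogonality turns the splitting at `q` into additivity of masses: almost every spectral set
    -- lies on one side of `q`.
    have horth : inner 𝕜 (A.proj 𝕜 (Ioc a (q : ℝ)) h) (A.proj 𝕜 (Ico (q : ℝ) b) h) = 0 := by
      rw [A.inner_proj_left, A.proj_proj e₂.finite_frontier, inter_comm, hinter, inner_zero_right]
    have hnorm := norm_add_sq_eq_norm_sq_add_norm_sq_of_inner_eq_zero _ _ horth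
    rw [hadd _ hq, ← sq, ← sq, ← sq] at hnorm
    set S₁ : Set (Compacts ℝ) := {M | (M : Set ℝ) ⊆ Ioc a (q : ℝ)} with hS₁
    set S₂ : Set (Compacts ℝ) := {M | (M : Set ℝ) ⊆ Ico (q : ℝ) b} with hS₂
    have m₁ : MeasurableSet S₁ := measurableSet_compacts_subset e₁.finite_frontier
    have m₂ : MeasurableSet S₂ := measurableSet_compacts_subset e₂.finite_frontier
    have hzero : A.spectralMeasure h (S₁ ∩ S₂) = 0 := by
      have := A.spectralMeasure_subset_eq_zero (e₁.inter e₂) hinter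
      simpa only [subset_inter_iff, ofPred_and] using this
    have hunion := measure_union_add_inter (μ := A.spectralMeasure h) S₁ m₂
    rw [hzero, add_zero, hS₁, hS₂, A.spectralMeasure_subset h e₁, A.spectralMeasure_subset h e₂,
      ← ENNReal.ofReal_add (by positivity) (by positivity), ← hnorm, ← A.spectralMeasure_univ,
      ← hS₁, ← hS₂] at hunion
    have hcompl : A.spectralMeasure h (S₁ ∪ S₂)ᶜ = 0 := by
      rw [measure_compl (m₁.union m₂) (measure_ne_top _ _), hunion, tsub_self]
    refine measure_mono_null (fun M hM => ?_) hcompl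
    exact fun hh => hh.elim hM.2.1 hM.2.2
  have h₁ := A.spectralMeasure_compl_subset_eq_zero ordConnected_Ioo.isElementarySet hab
  have h₂ := A.spectralMeasure_subset_eq_zero (ordConnected_empty (α := ℝ)).isElementarySet hempty
  refine measure_mono_null ?_ (measure_union_null (measure_union_null h₁ h₂)
    (measure_iUnion_null hsplit))
  intro M hM
  by_contra hcon
  simp only [mem_union, mem_compl_iff, mem_iUnion, mem_ofPred_eq, not_or, not_exists, not_not,
    not_and] at hcon
  obtain ⟨⟨hsub, hne⟩, hq⟩ := hcon
  rw [subset_empty_iff, ← Ne, ← nonempty_iff_ne_empty] at hne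
  obtain ⟨x, hx⟩ := hne
  refine hM ⟨x, eq_singleton_iff_unique_mem.2 ⟨hx, fun y hy => ?_⟩⟩
  have key : ∀ u ∈ (M : Set ℝ), ∀ v ∈ (M : Set ℝ), ¬ u < v := by
    intro u hu v hv huv
    obtain ⟨q, hq₁, hq₂⟩ := exists_rat_btwn huv
    have hqab : (q : ℝ) ∈ Ioo a b := ⟨(hsub hu).1.trans hq₁, hq₂.trans (hsub hv).2⟩
    by_cases hc : (M : Set ℝ) ⊆ Ioc a q
    · exact (hc hv).2.not_gt hq₂
    · exact (hq q hqab hc hu).1.not_gt hq₁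
  exact le_antisymm (not_lt.1 (key x hx y hy)) (not_lt.1 (key y hy x hx))

theorem proj_indicatorMul {E : Set ℝ} {B : Set Ω} (hB : MeasurableSet B)
    (hBE : MeasurableSet[A.fieldOf E] B) (f : Lp 𝕜 2 P) :
    A.proj 𝕜 E (indicatorMul hB f) = indicatorMul hB (A.proj 𝕜 E f) := by
  refine Lp.ext ?_
  calc (A.proj 𝕜 E (indicatorMul hB f) : Ω → 𝕜)
      =ᵐ[P] P[(indicatorMul hB f : Ω → 𝕜)|A.fieldOf E] := A.coeFn_proj _ _
    _ =ᵐ[P] P[B.indicator (f : Ω → 𝕜)|A.fieldOf E] := condExp_congr_ae (coeFn_indicatorMul hB f)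
    _ =ᵐ[P] B.indicator (P[(f : Ω → 𝕜)|A.fieldOf E]) := condExp_indicator (Lp.integrable_two f) hBE
    _ =ᵐ[P] B.indicator (A.proj 𝕜 E f) := by
      filter_upwards [A.coeFn_proj E f] with x hx
      by_cases hxB : x ∈ B <;> simp [hxB, hx]
    _ =ᵐ[P] indicatorMul hB (A.proj 𝕜 E f) := (coeFn_indicatorMul hB _).symm

/-- If all conditional expectations given `F_E` of the products of `f` with indicators of events
of `F_{Eᶜ}` vanish, then `f = 0`. -/
theorem eq_zero_of_proj_indicatorMul_eq_zero {E : Set ℝ} (hE : (frontier E).Finite)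
    {f : Lp 𝕜 2 P} (h : ∀ B (hB : MeasurableSet[A.fieldOf Eᶜ] B),
      A.proj 𝕜 E (indicatorMul (A.fieldOf_le _ B hB) f) = 0) : f = 0 := by
  have hgen : mΩ = A.fieldOf E ⊔ A.fieldOf Eᶜ := by
    have := A.fieldOf_eq_sup hE univ
    rwa [A.fieldOf_univ, univ_inter, ← compl_eq_univ_sdiff] at this
  have hrect : ∀ C B, MeasurableSet[A.fieldOf E] C → MeasurableSet[A.fieldOf Eᶜ] B →
      ∫ x in C ∩ B, f x ∂P = 0 := by
    intro C B hC hB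
    have hB' := A.fieldOf_le _ B hB
    rw [← setIntegral_indicator hB', ← setIntegral_congr_ae (A.fieldOf_le _ C hC)
      ((coeFn_indicatorMul hB' f).mono fun x hx _ => hx), ← A.setIntegral_proj E _ hC,
      h B hB, setIntegral_congr_ae (A.fieldOf_le _ C hC)
      ((Lp.coeFn_zero 𝕜 2 P).mono fun x hx _ => hx)]
    simp
  have hall : ∀ C, MeasurableSet C → ∫ x in C, f x ∂P = 0 := by
    intro C hC
    refine setIntegral_eq_zero_of_isPiSystem le_rfl
      (hgen.trans (MeasurableSpace.sup_eq_generateFrom_image2_inter _ _))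
      (MeasurableSpace.isPiSystem_image2_inter _ _) (Lp.integrable_two f) ?_ ?_ hC
    · simpa using hrect univ univ MeasurableSet.univ MeasurableSet.univ
    · rintro _ ⟨C, hC, B, hB, rfl⟩
      exact hrect C B hC hB
  refine Lp.ext (((Lp.integrable_two f).ae_eq_zero_of_forall_setIntegral_eq_zero
    fun s hs _ => hall s hs).trans (Lp.coeFn_zero 𝕜 2 P).symm)

/-- For an event `B` of the outside, multiplication by its indicator commutes with the projections
for sets containing `(a, b)ᶜ`. So the projection of the product to `(a, b)` inherits the additive
splitting of `g`, and not all these projections vanish. -/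
theorem exists_mem_firstChaos_ne_zero {a b : ℝ} {g : Lp 𝕜 2 P} (hg : g ≠ 0)
    (hempty : A.proj 𝕜 (Ioo a b)ᶜ g = 0)
    (hadd : ∀ t ∈ Ioo a b,
      A.proj 𝕜 ((Ioo a b)ᶜ ∪ Ioc a t) g + A.proj 𝕜 ((Ioo a b)ᶜ ∪ Ico t b) g = g) :
    ∃ h ∈ A.firstChaos 𝕜, h ≠ (0 : Lp 𝕜 2 P) := by
  have hI : (frontier (Ioo a b)).Finite := finite_frontier_of_ordConnected ordConnected_Ioo
  by_contra! hcon
  refine hg (A.eq_zero_of_proj_indicatorMul_eq_zero hI fun B hB => hcon _ ?_)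
  have hB' := A.fieldOf_le _ B hB
  have key : ∀ E ⊆ Ioo a b, (frontier E).Finite →
      A.proj 𝕜 E (A.proj 𝕜 (Ioo a b) (indicatorMul hB' g))
        = A.proj 𝕜 (Ioo a b) (indicatorMul hB' (A.proj 𝕜 ((Ioo a b)ᶜ ∪ E) g)) := by
    intro E hEI hE
    rw [← A.proj_indicatorMul hB' (A.fieldOf_mono subset_union_left _ hB),
      A.proj_proj (finite_frontier_union (finite_frontier_compl hI) hE), A.proj_proj hI]
    congr 2
    ext x
    have : x ∈ E → x ∈ Ioo a b := fun hx => hEI hx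
    simp only [mem_inter_iff, mem_union, mem_compl_iff]
    tauto
  refine A.mem_firstChaos_of_proj_add_proj (a := a) (b := b) (A.proj_proj_self hI _) ?_ ?_
  · rw [key ∅ (empty_subset _) (by simp), union_empty, hempty, indicatorMul_zero, map_zero]
  · intro t ht
    have h' : ∀ s : Set ℝ, s ⊆ Icc a b → A.proj 𝕜 s = A.proj 𝕜 (s ∩ Ioo a b) := by
      intro s hs
      refine A.proj_congr (A.fieldOf_congr (T := {a, b}) (by simp) ?_)
      ext x
      simp only [Set.mem_sdiff, mem_inter_iff, mem_insert_iff, mem_singleton_iff, not_or, mem_Ioo]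
      refine ⟨fun hx => ⟨⟨hx.1, lt_of_le_of_ne (hs hx.1).1 (Ne.symm hx.2.1),
        lt_of_le_of_ne (hs hx.1).2 hx.2.2⟩, hx.2⟩, fun hx => ⟨hx.1.1, hx.2⟩⟩
    have h₁ : Ioc a t ⊆ Ioo a b := fun x hx => ⟨hx.1, hx.2.trans_lt ht.2⟩
    have h₂ : Ico t b ⊆ Ioo a b := fun x hx => ⟨ht.1.trans_le hx.1, hx.2⟩
    rw [key _ h₁ (finite_frontier_of_ordConnected ordConnected_Ioc),
      key _ h₂ (finite_frontier_of_ordConnected ordConnected_Ico), ← map_add, ← indicatorMul_add,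
      hadd t ht]

/-- If the first chaos is trivial, then spectral sets almost surely do not meet a given open
interval in exactly one point. -/
theorem spectralMeasure_inter_Ioo_singleton (hA : A.firstChaos 𝕜 = {0}) (a b : ℝ)
    (f : Lp 𝕜 2 P) :
    A.spectralMeasure f {M | ∃ x, (M : Set ℝ) ∩ Ioo a b = {x}} = 0 := by
  set 𝓜 : Set (Compacts ℝ) := {M | ∃ x, (M : Set ℝ) ∩ Ioo a b = {x}} with h𝓜
  rw [← A.mem_nullSubspace]
  suffices htop : A.nullSubspace 𝕜 𝓜 = ⊤ by rw [htop]; trivial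
  have hcomplete : CompleteSpace (A.nullSubspace 𝕜 𝓜) :=
    (A.isClosed_nullSubspace 𝓜).completeSpace_coe
  rw [← Submodule.orthogonal_eq_bot_iff, Submodule.eq_bot_iff]
  intro g hg
  by_contra hg0
  have hcompl : (Ioo a b)ᶜ = Iic a ∪ Ici b := by
    ext x
    simp only [mem_compl_iff, mem_Ioo, not_and_or, not_lt, mem_union, mem_Iic, mem_Ici]
  have hO : IsElementarySet (Ioo a b)ᶜ := by
    rw [hcompl]
    exact ordConnected_Iic.isElementarySet.union ordConnected_Ici.isElementarySet
  have hzero : ∀ (v : Lp 𝕜 2 P), v ∈ A.nullSubspace 𝕜 𝓜 → inner 𝕜 v g = 0 := fun v hv =>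
    (Submodule.mem_orthogonal _ _).1 hg v hv
  have hOg : A.proj 𝕜 (Ioo a b)ᶜ g = 0 := by
    refine inner_self_eq_zero (𝕜 := 𝕜) |>.1 ?_
    rw [← A.inner_proj_left, A.proj_proj_self hO.finite_frontier]
    refine hzero _ (measure_mono_null ?_ (A.spectralMeasure_compl_subset_eq_zero hO
      (A.proj_proj_self hO.finite_frontier g)))
    rintro M ⟨x, hx⟩ hM
    have : x ∈ (M : Set ℝ) ∩ Ioo a b := by rw [hx]; rfl
    exact hM this.1 this.2
  have hadd : ∀ t ∈ Ioo a b,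
      A.proj 𝕜 ((Ioo a b)ᶜ ∪ Ioc a t) g + A.proj 𝕜 ((Ioo a b)ᶜ ∪ Ico t b) g = g := by
    intro t ht
    set E₁ := (Ioo a b)ᶜ ∪ Ioc a t with hE₁
    set E₂ := (Ioo a b)ᶜ ∪ Ico t b with hE₂
    have e₁ : IsElementarySet E₁ := hO.union ordConnected_Ioc.isElementarySet
    have e₂ : IsElementarySet E₂ := hO.union ordConnected_Ico.isElementarySet
    have hinter : A.proj 𝕜 (E₁ ∩ E₂) = A.proj 𝕜 (Ioo a b)ᶜ := by
      refine A.proj_congr (A.fieldOf_congr (finite_singleton t) ?_)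
      ext x
      simp only [hE₁, hE₂, ← union_inter_distrib_left, Set.mem_sdiff, mem_union, mem_inter_iff,
        mem_Ioc, mem_Ico, mem_singleton_iff]
      refine and_congr_left fun hxt => or_iff_left ?_
      exact fun hx => hxt (le_antisymm hx.1.2 hx.2.1)
    have h₁₁ : A.proj 𝕜 ((Ioo a b)ᶜ ∩ E₁) = A.proj 𝕜 (Ioo a b)ᶜ := by
      rw [inter_eq_left.2 subset_union_left]
    have h₂₂ : A.proj 𝕜 ((Ioo a b)ᶜ ∩ E₂) = A.proj 𝕜 (Ioo a b)ᶜ := by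
      rw [inter_eq_left.2 subset_union_left]
    -- By inclusion-exclusion this vector is killed by the projections for `E₁` and `E₂`, so its
    -- spectral sets almost surely fit in neither. But a set with a single point `x` in `(a, b)`
    -- fits in `E₁` if `x ≤ t` and in `E₂` if `t ≤ x`.
    have hmem : ∀ v : Lp 𝕜 2 P,
        v - A.proj 𝕜 E₁ v - A.proj 𝕜 E₂ v + A.proj 𝕜 (Ioo a b)ᶜ v ∈ A.nullSubspace 𝕜 𝓜 := by
      intro v
      have p₁ := A.spectralMeasure_subset_eq_zero e₁
        (f := v - A.proj 𝕜 E₁ v - A.proj 𝕜 E₂ v + A.proj 𝕜 (Ioo a b)ᶜ v) (by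
          rw [map_add, map_sub, map_sub, A.proj_proj_self e₁.finite_frontier,
            A.proj_proj e₂.finite_frontier, A.proj_proj hO.finite_frontier, inter_comm, hinter, h₁₁]
          abel)
      have p₂ := A.spectralMeasure_subset_eq_zero e₂
        (f := v - A.proj 𝕜 E₁ v - A.proj 𝕜 E₂ v + A.proj 𝕜 (Ioo a b)ᶜ v) (by
          rw [map_add, map_sub, map_sub, A.proj_proj_self e₂.finite_frontier,
            A.proj_proj e₁.finite_frontier, A.proj_proj hO.finite_frontier, hinter, h₂₂]
          abel)
      refine measure_mono_null ?_ (measure_union_null p₁ p₂)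
      rintro M ⟨x, hx⟩
      have hM : ∀ y ∈ (M : Set ℝ), y ∈ Ioo a b → y = x := fun y hy hyI => by
        have : y ∈ (M : Set ℝ) ∩ Ioo a b := ⟨hy, hyI⟩
        rw [hx] at this
        exact this
      rcases le_total x t with hxt | hxt
      · refine Or.inl fun y hy => or_iff_not_imp_left.2 fun hyI => ?_
        rw [notMem_compl_iff] at hyI
        exact ⟨hyI.1, (hM y hy hyI).le.trans hxt⟩
      · refine Or.inr fun y hy => or_iff_not_imp_left.2 fun hyI => ?_
        rw [notMem_compl_iff] at hyI
        exact ⟨hxt.trans (hM y hy hyI).ge, hyI.2⟩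
    -- Self-adjointness moves the operator from `v` to `g`, where the term for `(a, b)ᶜ` vanishes.
    have horth : ∀ v : Lp 𝕜 2 P, inner 𝕜 v (g - A.proj 𝕜 E₁ g - A.proj 𝕜 E₂ g) = 0 := by
      intro v
      have := hzero _ (hmem v)
      rw [inner_add_left, inner_sub_left, inner_sub_left, A.inner_proj_left, A.inner_proj_left,
        A.inner_proj_left, hOg, inner_zero_right, add_zero] at this
      rw [inner_sub_right, inner_sub_right, this]
    have := inner_self_eq_zero (𝕜 := 𝕜) |>.1 (horth _)
    rw [sub_sub, sub_eq_zero] at this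
    exact this.symm
  obtain ⟨h, hh, hne⟩ := A.exists_mem_firstChaos_ne_zero hg0 hOg hadd
  rw [hA] at hh
  exact hne hh

theorem exists_rat_inter_Ioo_singleton_of_not_perfect {M : Compacts ℝ}
    (hM : M ∉ perfectCompacts) : ∃ a b : ℚ, ∃ x, (M : Set ℝ) ∩ Ioo (a : ℝ) b = {x} := by
  have hM' : ¬ Preperfect (M : Set ℝ) := fun h => hM ⟨M.isCompact.isClosed, h⟩
  simp only [Preperfect, not_forall] at hM'
  obtain ⟨x, hx, hacc⟩ := hM'
  rw [accPt_iff_nhds] at hacc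
  push Not at hacc
  obtain ⟨U, hU, hUM⟩ := hacc
  obtain ⟨V, ⟨hV, hxV, hVU⟩⟩ := Real.isTopologicalBasis_Ioo_rat.mem_nhds_iff.1 hU
  obtain ⟨a, b, -, rfl⟩ : ∃ a b : ℚ, a < b ∧ V = Ioo (a : ℝ) b := by simpa using hV
  refine ⟨a, b, x, eq_singleton_iff_unique_mem.2 ⟨⟨hx, hxV⟩, fun y hy => ?_⟩⟩
  exact hUM y ⟨hVU hy.2, hy.1⟩

theorem firstChaos_eq_iff_perfect :
    A.firstChaos 𝕜 = {0} ↔ ∀ f : Lp 𝕜 2 P, ∀ᵐ M ∂(A.spectralMeasure f), M ∈ perfectCompacts := by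
  constructor
  · intro hA f
    have h : A.spectralMeasure f
        (⋃ (a : ℚ) (b : ℚ), {M | ∃ x, (M : Set ℝ) ∩ Ioo (a : ℝ) b = {x}}) = 0 :=
      measure_iUnion_null fun a => measure_iUnion_null fun b =>
        A.spectralMeasure_inter_Ioo_singleton hA a b f
    refine measure_mono_null (fun M hM => ?_) h
    obtain ⟨a, b, hab⟩ := exists_rat_inter_Ioo_singleton_of_not_perfect hM
    exact mem_iUnion₂.2 ⟨a, b, hab⟩
  · intro h
    refine subset_antisymm (fun f hf => ?_) ?_
    · refine A.eq_zero_of_spectralMeasure_eq_zero ?_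
      refine measure_mono_null ?_ (measure_union_null hf (h f))
      intro M _
      by_contra hcon
      rw [mem_union, not_or, notMem_compl_iff, notMem_compl_iff] at hcon
      obtain ⟨⟨t, ht⟩, hperf⟩ := hcon
      have hacc := hperf.acc t (by rw [ht]; rfl)
      rw [ht] at hacc
      exact absurd hacc (by rw [accPt_iff_nhds]; push Not; exact ⟨univ, univ_mem, by simp⟩)
    · rintro _ rfl
      change A.spectralMeasure 0 _ = 0
      rw [A.spectralMeasure_zero]
      rfl

end ContinuousFactorization

namespace ContinuousFactorization

variable {𝕜 : Type*} [RCLike 𝕜] {Ω : Type*} [mΩ : MeasurableSpace Ω] {P : Measure Ω}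
  (A : ContinuousFactorization P) [IsProbabilityMeasure P]

/-! ### The stable sigma-field -/

theorem eq_empty_of_finite_of_perfect {M : Compacts ℝ} (hfin : M ∈ finiteCompacts)
    (hperf : M ∈ perfectCompacts) : (M : Set ℝ) = ∅ := by
  by_contra hne
  obtain ⟨x, hx⟩ := nonempty_iff_ne_empty.2 hne
  have hacc := hperf.acc x hx
  have hd : IsClosed ((M : Set ℝ) \ {x}) := (Set.Finite.subset hfin sdiff_subset).isClosed
  rw [accPt_iff_nhds] at hacc
  obtain ⟨y, ⟨hy, hyM⟩, hyx⟩ := hacc _ (hd.isOpen_compl.mem_nhds fun h => h.2 rfl)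
  exact hy ⟨hyM, hyx⟩

theorem proj_empty_eq_self_of_ae_const {f : Lp 𝕜 2 P} {c : 𝕜} (hf : f =ᵐ[P] fun _ => c) :
    A.proj 𝕜 ∅ f = f :=
  A.proj_eq_of_setIntegral_eq ⟨fun _ => c, stronglyMeasurable_const, hf⟩ fun _ _ => rfl

theorem proj_empty_ae_const (f : Lp 𝕜 2 P) : A.proj 𝕜 ∅ f =ᵐ[P] fun _ => ∫ x, f x ∂P := by
  refine (A.coeFn_proj ∅ f).trans ?_
  rw [A.fieldOf_finite finite_empty, condExp_bot]

/-- Single points are finite sets, so elements of the first chaos are stable and hence constant. The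
spectral measure of a constant sits at `∅`, which is not a single-point set. -/
theorem firstChaos_eq_of_stableField_degenerate
    (h : ∀ D, MeasurableSet[A.stableField 𝕜] D → P D = 0 ∨ P D = 1) : A.firstChaos 𝕜 = {0} := by
  refine subset_antisymm (fun f hf => ?_) ?_
  · have hstable : A.IsStable f := by
      refine measure_mono_null (compl_subset_compl.2 ?_) hf
      rintro M ⟨t, ht⟩
      change (M : Set ℝ).Finite
      rw [ht]
      exact finite_singleton t
    obtain ⟨c, hc⟩ : ∃ c : 𝕜, f =ᵐ[P] fun _ => c := by
      refine Filter.exists_eventuallyEq_const_of_forall_separating MeasurableSet fun B hB => ?_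
      have hms : MeasurableSet ((f : Ω → 𝕜) ⁻¹' B) :=
        (Lp.stronglyMeasurable f).measurable hB
      have hD : MeasurableSet[A.stableField 𝕜] ((f : Ω → 𝕜) ⁻¹' B) := by
        refine MeasurableSpace.measurableSet_generateFrom ⟨hms, f, hstable, B, ?_, ae_eq_refl _⟩
        rwa [← BorelSpace.measurable_eq]
      rcases h _ hD with h0 | h1
      · exact Or.inr (measure_eq_zero_iff_ae_notMem.1 h0)
      · exact Or.inl ((prob_compl_eq_zero_iff hms).2 h1)
    have h₁ := A.proj_empty_eq_self_of_ae_const hc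
    refine A.eq_zero_of_spectralMeasure_eq_zero ?_
    have h₂ : A.spectralMeasure f {M | (M : Set ℝ) ⊆ ∅} = 0 := by
      have hf' : A.spectralMeasure f singlePointCompactsᶜ = 0 := hf
      have hsub : {M : Compacts ℝ | (M : Set ℝ) ⊆ ∅} ⊆ singlePointCompactsᶜ := by
        rintro M hM ⟨t, ht⟩
        rw [mem_ofPred_eq, ht] at hM
        exact hM rfl
      exact measure_mono_null hsub hf'
    rw [A.spectralMeasure_subset f (ordConnected_empty (α := ℝ)).isElementarySet, h₁] at h₂
    rw [A.spectralMeasure_univ, h₂]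
  · rintro _ rfl
    change A.spectralMeasure 0 _ = 0
    rw [A.spectralMeasure_zero]
    rfl

theorem stableField_degenerate_of_perfect
    (h : ∀ f : Lp 𝕜 2 P, ∀ᵐ M ∂(A.spectralMeasure f), M ∈ perfectCompacts) (D : Set Ω)
    (hD : MeasurableSet[A.stableField 𝕜] D) : P D = 0 ∨ P D = 1 := by
  have hconst : ∀ f : Lp 𝕜 2 P, A.IsStable f → f =ᵐ[P] fun _ => ∫ x, f x ∂P := by
    intro f hf
    have h₁ : A.spectralMeasure f {M | (M : Set ℝ) ⊆ ∅}ᶜ = 0 := by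
      refine measure_mono_null (fun M hM => ?_) (measure_union_null hf (h f))
      by_contra hcon
      rw [mem_union, not_or, notMem_compl_iff, notMem_compl_iff] at hcon
      exact hM (eq_empty_of_finite_of_perfect hcon.1 hcon.2).subset
    have hE := (ordConnected_empty (α := ℝ)).isElementarySet
    have h₂ := measure_add_measure_compl (μ := A.spectralMeasure f)
      (measurableSet_compacts_subset hE.finite_frontier)
    rw [h₁, add_zero, A.spectralMeasure_subset f hE, A.spectralMeasure_univ,
      ENNReal.ofReal_eq_ofReal_iff (by positivity) (by positivity)] at h₂
    have h₃ := A.norm_sq_eq_add f hE.finite_frontier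
    have h₄ : ‖f - A.proj 𝕜 ∅ f‖ ^ 2 = 0 := by linarith
    have h₅ : f = A.proj 𝕜 ∅ f := sub_eq_zero.1 (norm_eq_zero.1 (pow_eq_zero_iff two_ne_zero |>.1 h₄))
    have h₆ := A.proj_empty_ae_const f
    rwa [← h₅] at h₆
  -- In terms of null sets the dichotomy is symmetric under complements and needs no measurability
  -- in the induction.
  have key : P D = 0 ∨ P Dᶜ = 0 := by
    refine MeasurableSpace.generateFrom_induction _ (fun D _ => P D = 0 ∨ P Dᶜ = 0)
      ?_ ?_ ?_ ?_ D hD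
    · rintro D ⟨-, f, hf, B, -, hDB⟩ -
      by_cases hB : ∫ x, f x ∂P ∈ B
      · refine Or.inr ?_
        have : ∀ᵐ x ∂P, x ∈ D := by
          filter_upwards [hDB, hconst f hf] with x hx hfx
          have : x ∈ (f : Ω → 𝕜) ⁻¹' B := by rwa [mem_preimage, hfx]
          exact (eq_iff_iff.1 hx).2 this
        exact this
      · refine Or.inl (measure_eq_zero_iff_ae_notMem.2 ?_)
        filter_upwards [hDB, hconst f hf] with x hx hfx hxD
        have : x ∈ (f : Ω → 𝕜) ⁻¹' B := (eq_iff_iff.1 hx).1 hxD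
        rw [mem_preimage, hfx] at this
        exact hB this
    · exact Or.inl measure_empty
    · intro D _ hD
      rw [compl_compl]
      exact hD.symm
    · intro s _ hs
      by_cases hall : ∀ n, P (s n) = 0
      · exact Or.inl (measure_iUnion_null hall)
      · push Not at hall
        obtain ⟨n, hn⟩ := hall
        refine Or.inr (measure_mono_null ?_ ((hs n).resolve_left hn))
        exact compl_subset_compl.2 (subset_iUnion s n)
  refine key.imp_right fun hc => le_antisymm prob_le_one ?_
  have := measure_union_le (μ := P) D Dᶜ
  rwa [union_compl_self, measure_univ, hc, add_zero] at this

end ContinuousFactorization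

/-- First part: spectral measures exist and are unique, and the first chaos of a continuous
factorization is trivial if and only if all spectral measures are concentrated on perfect sets.
Second part: a noise is black if and only if all spectral measures are concentrated on perfect
sets. Here `𝕜` is `ℝ` or `ℂ`, and `L₂` consists of `𝕜`-valued random variables. -/
theorem theorem6p20 {𝕜 : Type*} [RCLike 𝕜] {Ω : Type*} [MeasurableSpace Ω]
    (P : Measure Ω) [IsProbabilityMeasure P] :
    (∀ A : ContinuousFactorization P,
      (∀ f : Lp 𝕜 2 P, ∃! μ : Measure (Compacts ℝ), A.IsSpectralMeasure f μ) ∧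
      (A.firstChaos 𝕜 = {0} ↔
        ∀ f : Lp 𝕜 2 P, ∀ᵐ M ∂(A.spectralMeasure f), M ∈ perfectCompacts)) ∧
    (∀ N : Noise P,
      N.IsBlack 𝕜 ↔
        ∀ f : Lp 𝕜 2 P,
          ∀ᵐ M ∂(N.toContinuousFactorization.spectralMeasure f), M ∈ perfectCompacts) := by
  refine ⟨fun A => ⟨A.existsUnique_isSpectralMeasure, A.firstChaos_eq_iff_perfect⟩, fun N => ?_⟩
  refine ⟨fun h => ?_, N.toContinuousFactorization.stableField_degenerate_of_perfect⟩
  exact N.toContinuousFactorization.firstChaos_eq_iff_perfect.1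
    (N.toContinuousFactorization.firstChaos_eq_of_stableField_degenerate h)
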